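/- Let $d\in\mathbb{N}$, $d\ge 1$, and let $E\neq\{0\}$ be a locally convex Hausdorff space over $\mathbb{C}$ which is locally complete, i.e. for every closed, bounded, absolutely convex set $D\subset E$ the space $E_D=\bigcup_{n\in\mathbb{N}}nD$, normed by the gauge of $D$, is a Banach space. Let $\mathcal{C}^\infty(\mathbb{R}^d,E)$ be the space of infinitely continuously partially differentiable functions $f\colon\mathbb{R}^d\to E$ with the locally convex topology given by the seminorms $$|f|_{K,l,p}=\sup_{x\in K,\ \beta\in\mathbb{N}_0^d,\ |\beta|\le l}p\bigl(\partial^\beta f(x)\bigr),$$ where $K\subset\mathbb{R}^d$ is compact, $l\in\mathbb{N}_0$, $|\beta|=\beta_1+\dots+\beta_d$, and $p$ is a continuous seminorm on $E$, and let $\mathcal{C}^\infty_{2\pi}(\mathbb{R}^d,E)$ be its topological subspace of the functions that are $2\pi$-periodic in each variable. Then for all $f\in\mathcal{C}^\infty_{2\pi}(\mathbb{R}^d,E)$ and $n\in\mathbb{Z}^d$ the function $x\mapsto f(x)e^{-i\langle n,x\rangle}$ is Pettis-integrable on $[-\pi,\pi]^d$ with respect to Lebesgue measure, i.e. its compositions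 with all $e'\in E'$ are integrable there and their integrals are $e'(v)$ for a (unique) vector $v\in E$, the Pettis integral. With the Fourier coefficients $$\widehat f(n)=(2\pi)^{-d}\int_{[-\pi,\pi]^d}f(x)e^{-i\langle n,x\rangle}\,dx\in E$$ and the Euclidean norm $|n|$ on $\mathbb{Z}^d$, the maps $$P_k f=\sum_{n\in\mathbb{Z}^d,\ |n|\le k}\widehat f(n)e^{i\langle n,\cdot\rangle},\qquad k=0,1,2,\dots,$$ form a Schauder decomposition of $\mathcal{C}^\infty_{2\pi}(\mathbb{R}^d,E)$: they are continuous linear projections of this space into itself, $P_kP_j=P_{\min(j,k)}$ for all $j,k$, $P_k\neq P_j$ for $k\neq j$, and $P_kf\to f$ for every $f$. Moreover, every $f\in\mathcal{C}^\infty_{2\pi}(\mathbb{R}^d,E)$ is the sum of its Fourier series, $$f=\sum_{n\in\mathbb{Z}^d}\widehat f(n)e^{i\langle n,\cdot\rangle},$$ with unconditional convergence in $\mathcal{C}^\infty_{2\pi}(\mathbb{R}^d,E)$ (the sums over finite subsets of $\mathbb{Z}^d$, directed by inclusion, converge to $f$). -/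

import Mathlib

open Filter Topology MeasureTheory

set_option linter.unusedSectionVars false

namespace SmoothFourier

noncomputable section

/-! ### Locally complete spaces -/

section LocallyComplete

variable (E : Type*) [AddCommGroup E] [Module ℂ E] [TopologicalSpace E]

/-- A disk is a bounded, absolutely convex set. -/
def IsDisk (D : Set E) : Prop :=
  Bornology.IsVonNBounded ℂ D ∧ Balanced ℂ D ∧ Convex ℝ D

variable {E} in
/-- The underlying set of the space `E_D = ⋃ n, n D`, normed by the gauge of `D`. -/
def diskSpan (D : Set E) : Set E := ⋃ n : ℕ, (fun y : E => (n : ℂ) • y) '' D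

/-- `E` is locally complete if, for every closed disk `D`, the space `E_D` with the gauge of `D` as
its norm is a Banach space, that is, every Cauchy sequence of `E_D` converges in `E_D`. -/
def IsLocallyComplete : Prop :=
  ∀ D : Set E, IsDisk E D → IsClosed D →
    ∀ u : ℕ → E, (∀ k, u k ∈ diskSpan D) →
      (∀ ε : ℝ, 0 < ε → ∃ N : ℕ, ∀ m ≥ N, ∀ k ≥ N, gauge D (u m - u k) < ε) →
      ∃ x ∈ diskSpan D, Tendsto (fun k => gauge D (u k - x)) atTop (𝓝 0)

end LocallyComplete

/-! ### Schauder decompositions -/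

/-- A Schauder decomposition: continuous linear projections `P k` with `P k P j = P (min j k)`,
pairwise different, and converging pointwise to the identity.  (That `P k` is a projection is the
case `j = k` of the first condition.) -/
structure IsSchauderDecomposition {F : Type*} [AddCommGroup F] [Module ℂ F] [TopologicalSpace F]
    (P : ℕ → F →L[ℂ] F) : Prop where
  comp_eq : ∀ j k, (P k).comp (P j) = P (min j k)
  ne_of_ne : ∀ j k, k ≠ j → P k ≠ P j
  tendsto : ∀ f : F, Tendsto (fun k => P k f) atTop (𝓝 f)

/-! ### The Pettis integral -/

section Pettis

variable {X : Type*} [MeasurableSpace X] {E : Type*} [AddCommGroup E] [Module ℂ E]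
  [TopologicalSpace E]

/-- `e` is a Pettis integral of `f` over `s`. -/
def IsPettisIntegral (f : X → E) (s : Set X) (μ : Measure X) (e : E) : Prop :=
  ∀ φ : E →L[ℂ] ℂ, φ e = ∫ x in s, φ (f x) ∂μ

/-- `f` is Pettis-integrable on `s`: it is weakly integrable on `s`, and there is a vector
representing the weak integrals. -/
def PettisIntegrableOn (f : X → E) (s : Set X) (μ : Measure X) : Prop :=
  (∀ φ : E →L[ℂ] ℂ, IntegrableOn (fun x => φ (f x)) s μ) ∧ ∃ e : E, IsPettisIntegral f s μ e

open Classical in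
/-- The Pettis integral of `f` over `s` (and `0` if `f` is not Pettis-integrable on `s`).  In a
locally convex Hausdorff space the vector is unique. -/
def pettisIntegral (f : X → E) (s : Set X) (μ : Measure X) : E :=
  if h : PettisIntegrableOn f s μ then h.2.choose else 0

end Pettis

/-! ### Partial derivatives and smooth functions on `ℝᵈ` -/

section Smooth

variable {d : ℕ} {E : Type*} [AddCommGroup E] [Module ℂ E] [TopologicalSpace E]

/-- `e` is the limit of the difference quotients of `f` at `x` in the `i`-th coordinate. -/
def HasPartialDerivAt (i : Fin d) (f : EuclideanSpace ℝ (Fin d) → E) (e : E)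
    (x : EuclideanSpace ℝ (Fin d)) : Prop :=
  Tendsto (fun h : ℝ => h⁻¹ • (f (x + h • EuclideanSpace.single i (1 : ℝ)) - f x))
    (𝓝[≠] 0) (𝓝 e)

open Classical in
/-- The `i`-th partial derivative of `f` (with value `0` at points where it does not exist). -/
def partialDeriv (i : Fin d) (f : EuclideanSpace ℝ (Fin d) → E) :
    EuclideanSpace ℝ (Fin d) → E :=
  fun x => if h : ∃ e, HasPartialDerivAt i f e x then h.choose else 0

/-- `f` is `k`-times continuously partially differentiable. -/
def IsCk : ℕ → (EuclideanSpace ℝ (Fin d) → E) → Prop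
  | 0, f => Continuous f
  | k + 1, f => ∀ i : Fin d, (∀ x, ∃ e, HasPartialDerivAt i f e x) ∧
      Continuous (partialDeriv i f) ∧ IsCk k (partialDeriv i f)

/-- `f` is infinitely continuously partially differentiable. -/
def IsSmooth (f : EuclideanSpace ℝ (Fin d) → E) : Prop := ∀ k, IsCk k f

lemma IsSmooth.continuous {f : EuclideanSpace ℝ (Fin d) → E} (hf : IsSmooth f) : Continuous f :=
  hf 0

lemma IsSmooth.partialDeriv {f : EuclideanSpace ℝ (Fin d) → E} (hf : IsSmooth f) (i : Fin d) :
    IsSmooth (partialDeriv i f) := fun k => ((hf (k + 1)) i).2.2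

variable [T2Space E]

lemma HasPartialDerivAt.partialDeriv_eq {i : Fin d} {f : EuclideanSpace ℝ (Fin d) → E} {e : E}
    {x : EuclideanSpace ℝ (Fin d)} (h : HasPartialDerivAt i f e x) : partialDeriv i f x = e := by
  have h' : ∃ e, HasPartialDerivAt i f e x := ⟨e, h⟩
  unfold SmoothFourier.partialDeriv
  rw [dif_pos h']
  exact tendsto_nhds_unique h'.choose_spec h

lemma IsSmooth.hasPartialDerivAt {f : EuclideanSpace ℝ (Fin d) → E} (hf : IsSmooth f) (i : Fin d)
    (x : EuclideanSpace ℝ (Fin d)) : HasPartialDerivAt i f (SmoothFourier.partialDeriv i f x) x := by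
  obtain ⟨e, he⟩ := ((hf 1) i).1 x
  rwa [he.partialDeriv_eq]

variable [IsTopologicalAddGroup E] [ContinuousSMul ℂ E]

lemma HasPartialDerivAt.add {i : Fin d} {f g : EuclideanSpace ℝ (Fin d) → E} {a b : E}
    {x : EuclideanSpace ℝ (Fin d)} (hf : HasPartialDerivAt i f a x)
    (hg : HasPartialDerivAt i g b x) : HasPartialDerivAt i (f + g) (a + b) x := by
  refine (Tendsto.add hf hg).congr fun h => ?_
  rw [← smul_add]; congr 1; simp only [Pi.add_apply]; abel

lemma HasPartialDerivAt.smul {i : Fin d} {f : EuclideanSpace ℝ (Fin d) → E} {a : E}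
    {x : EuclideanSpace ℝ (Fin d)} (c : ℂ) (hf : HasPartialDerivAt i f a x) :
    HasPartialDerivAt i (c • f) (c • a) x := by
  refine (Tendsto.const_smul hf c).congr fun h => ?_
  rw [smul_comm]; simp only [Pi.smul_apply, smul_sub]

lemma IsCk.zero (k : ℕ) : IsCk k (0 : EuclideanSpace ℝ (Fin d) → E) := by
  induction k with
  | zero => exact continuous_const
  | succ k ih =>
    intro i
    have h0 : ∀ x, HasPartialDerivAt i (0 : EuclideanSpace ℝ (Fin d) → E) 0 x := fun x => by
      simp [HasPartialDerivAt]
    have h1 : partialDeriv i (0 : EuclideanSpace ℝ (Fin d) → E) = 0 :=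
      funext fun x => (h0 x).partialDeriv_eq
    rw [h1]
    exact ⟨fun x => ⟨0, h0 x⟩, continuous_const, ih⟩

lemma partialDeriv_add {f g : EuclideanSpace ℝ (Fin d) → E} (i : Fin d)
    (hf : ∀ x, ∃ e, HasPartialDerivAt i f e x) (hg : ∀ x, ∃ e, HasPartialDerivAt i g e x) :
    partialDeriv i (f + g) = partialDeriv i f + partialDeriv i g := by
  funext x
  obtain ⟨a, ha⟩ := hf x
  obtain ⟨b, hb⟩ := hg x
  rw [(ha.add hb).partialDeriv_eq, Pi.add_apply, ha.partialDeriv_eq, hb.partialDeriv_eq]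

lemma partialDeriv_smul {f : EuclideanSpace ℝ (Fin d) → E} (i : Fin d) (c : ℂ)
    (hf : ∀ x, ∃ e, HasPartialDerivAt i f e x) :
    partialDeriv i (c • f) = c • partialDeriv i f := by
  funext x
  obtain ⟨a, ha⟩ := hf x
  rw [(ha.smul c).partialDeriv_eq, Pi.smul_apply, ha.partialDeriv_eq]

lemma IsCk.add {k : ℕ} {f g : EuclideanSpace ℝ (Fin d) → E} (hf : IsCk k f) (hg : IsCk k g) :
    IsCk k (f + g) := by
  induction k generalizing f g with
  | zero => exact Continuous.add hf hg
  | succ k ih =>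
    intro i
    rw [partialDeriv_add i (hf i).1 (hg i).1]
    refine ⟨fun x => ?_, (hf i).2.1.add (hg i).2.1, ih (hf i).2.2 (hg i).2.2⟩
    obtain ⟨a, ha⟩ := (hf i).1 x
    obtain ⟨b, hb⟩ := (hg i).1 x
    exact ⟨a + b, ha.add hb⟩

lemma IsCk.smul {k : ℕ} {f : EuclideanSpace ℝ (Fin d) → E} (c : ℂ) (hf : IsCk k f) :
    IsCk k (c • f) := by
  induction k generalizing f with
  | zero => exact Continuous.const_smul hf c
  | succ k ih =>
    intro i
    rw [partialDeriv_smul i c (hf i).1]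
    refine ⟨fun x => ?_, (hf i).2.1.const_smul c, ih (hf i).2.2⟩
    obtain ⟨a, ha⟩ := (hf i).1 x
    exact ⟨c • a, ha.smul c⟩

variable (d E) in
/-- The smooth functions, as a linear subspace of all functions. -/
def smoothSubmodule : Submodule ℂ (EuclideanSpace ℝ (Fin d) → E) where
  carrier := {f | IsSmooth f}
  add_mem' hf hg := fun k => (hf k).add (hg k)
  zero_mem' := fun k => IsCk.zero k
  smul_mem' c _ hf := fun k => (hf k).smul c

variable (d E) in
/-- The space `C^∞(ℝᵈ, E)`; a type of its own, because it carries its own topology. -/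
structure SmoothMap where
  /-- the underlying function, with the proof of its smoothness -/
  val : smoothSubmodule d E

namespace SmoothMap

instance : CoeFun (SmoothMap d E) (fun _ => EuclideanSpace ℝ (Fin d) → E) := ⟨fun f => f.val.1⟩

variable (d E) in
/-- The identification of `C^∞(ℝᵈ, E)` with a set of functions, which gives its pointwise linear
structure. -/
def equiv : SmoothMap d E ≃ smoothSubmodule d E where
  toFun := SmoothMap.val
  invFun := SmoothMap.mk
  left_inv _ := rfl
  right_inv _ := rfl

instance : AddCommGroup (SmoothMap d E) := (equiv d E).addCommGroup

instance : Module ℂ (SmoothMap d E) := (equiv d E).module ℂ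

lemma isSmooth (f : SmoothMap d E) : IsSmooth (f : EuclideanSpace ℝ (Fin d) → E) := f.val.2

@[simp] lemma coe_add (f g : SmoothMap d E) (x : EuclideanSpace ℝ (Fin d)) :
    (f + g) x = f x + g x := rfl

@[simp] lemma coe_smul (c : ℂ) (f : SmoothMap d E) (x : EuclideanSpace ℝ (Fin d)) :
    (c • f) x = c • f x := rfl

@[simp] lemma coe_zero (x : EuclideanSpace ℝ (Fin d)) : (0 : SmoothMap d E) x = 0 := rfl

/-- The partial derivative as a linear operator on `C^∞(ℝᵈ, E)`. -/
def pd (i : Fin d) : Module.End ℂ (SmoothMap d E) where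
  toFun f := ⟨⟨partialDeriv i f, f.isSmooth.partialDeriv i⟩⟩
  map_add' f g := congrArg SmoothMap.mk (Subtype.ext
    (partialDeriv_add i (fun x => ⟨_, f.isSmooth.hasPartialDerivAt i x⟩)
      (fun x => ⟨_, g.isSmooth.hasPartialDerivAt i x⟩)))
  map_smul' c f := congrArg SmoothMap.mk (Subtype.ext
    (partialDeriv_smul i c (fun x => ⟨_, f.isSmooth.hasPartialDerivAt i x⟩)))

/-- For a multi-index `β`, the operator `∂^β = ∂₁^β₁ ⋯ ∂_d^β_d` (products of endomorphisms are
compositions). -/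
def iteratedPd (β : Fin d → ℕ) : Module.End ℂ (SmoothMap d E) :=
  (List.ofFn fun i => pd i ^ β i).prod

lemma bddAbove_comp (K : TopologicalSpace.Compacts (EuclideanSpace ℝ (Fin d)))
    (p : {p : Seminorm ℂ E // Continuous p}) (f : SmoothMap d E) :
    BddAbove (Set.range fun x : K => p.1 (f x)) := by
  have h := (K.isCompact.image (p.2.comp f.isSmooth.continuous)).bddAbove
  rwa [Set.image_eq_range] at h

/-- The seminorm `f ↦ sup_{x ∈ K} p (f x)`. -/
def supSeminorm (K : TopologicalSpace.Compacts (EuclideanSpace ℝ (Fin d)))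
    (p : {p : Seminorm ℂ E // Continuous p}) : Seminorm ℂ (SmoothMap d E) :=
  Seminorm.of (fun f => ⨆ x : K, p.1 (f x))
    (fun f g => Real.iSup_le
      (fun x => (map_add_le_add p.1 _ _).trans
        (add_le_add (le_ciSup (bddAbove_comp K p f) x) (le_ciSup (bddAbove_comp K p g) x)))
      (add_nonneg (Real.iSup_nonneg fun _ => apply_nonneg _ _)
        (Real.iSup_nonneg fun _ => apply_nonneg _ _)))
    (fun c f => by
      rw [Real.mul_iSup_of_nonneg (norm_nonneg c)]
      exact iSup_congr fun x => by rw [coe_smul, map_smul_eq_mul])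

variable (d) in
/-- The multi-indices `β` with `|β| = β₁ + ⋯ + β_d ≤ l`. -/
def multiIndices (l : ℕ) : Finset (Fin d → ℕ) :=
  (Finset.Icc 0 (fun _ => l)).filter fun β => ∑ i, β i ≤ l

variable (d E) in
/-- The seminorms `|f|_{K,l,p} = sup {p (∂^β f x) : x ∈ K, |β| ≤ l}`, where `K` runs through the
compact sets, `l` through the natural numbers, and `p` through the continuous seminorms of `E`. -/
def seminormFamily : SeminormFamily ℂ (SmoothMap d E)
    (TopologicalSpace.Compacts (EuclideanSpace ℝ (Fin d)) × ℕ ×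
      {p : Seminorm ℂ E // Continuous p}) :=
  fun a => (multiIndices d a.2.1).sup fun β => (supSeminorm a.1 a.2.2).comp (iteratedPd β)

instance : Nonempty {p : Seminorm ℂ E // Continuous p} := ⟨⟨0, continuous_const⟩⟩

/-- The locally convex topology of `C^∞(ℝᵈ, E)` generated by the seminorms `|f|_{K,l,p}`. -/
instance : TopologicalSpace (SmoothMap d E) := (seminormFamily d E).moduleFilterBasis.topology

end SmoothMap

variable (d E) in
/-- The space `C^∞_{2π}(ℝᵈ, E)` of the smooth functions that are `2π`-periodic in each variable, a
topological subspace of `C^∞(ℝᵈ, E)`. -/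
def periodicSmooth : Submodule ℂ (SmoothMap d E) where
  carrier := {f | ∀ i : Fin d,
    Function.Periodic (f : EuclideanSpace ℝ (Fin d) → E) (EuclideanSpace.single i (2 * Real.pi))}
  add_mem' hf hg i x := by simp only [SmoothMap.coe_add, hf i x, hg i x]
  zero_mem' i x := by simp only [SmoothMap.coe_zero]
  smul_mem' c f hf i x := by simp only [SmoothMap.coe_smul, hf i x]

instance : CoeFun (periodicSmooth d E) (fun _ => EuclideanSpace ℝ (Fin d) → E) :=
  ⟨fun f => (f : SmoothMap d E)⟩

end Smooth

/-! ### Fourier coefficients and Fourier partial sums -/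

section Fourier

variable {d : ℕ}

/-- The scalar product `⟨n, x⟩` of `n ∈ ℤᵈ` and `x ∈ ℝᵈ`. -/
def pairing (n : Fin d → ℤ) (x : EuclideanSpace ℝ (Fin d)) : ℝ := ∑ i, (n i : ℝ) * x i

/-- The cube `[-π, π]ᵈ`. -/
def cube (d : ℕ) : Set (EuclideanSpace ℝ (Fin d)) := {x | ∀ i, x i ∈ Set.Icc (-Real.pi) Real.pi}

/-- The Euclidean norm of `n ∈ ℤᵈ`. -/
def latticeNorm (n : Fin d → ℤ) : ℝ := Real.sqrt (∑ i, (n i : ℝ) ^ 2)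

/-- The finite set `{n ∈ ℤᵈ : |n| ≤ k}`, for the Euclidean norm `|n|`. -/
def latticeBall (d k : ℕ) : Finset (Fin d → ℤ) := by
  classical
  exact (Finset.Icc (fun _ => -(k : ℤ)) (fun _ => (k : ℤ))).filter fun n => latticeNorm n ≤ k

lemma mem_latticeBall {k : ℕ} {n : Fin d → ℤ} : n ∈ latticeBall d k ↔ latticeNorm n ≤ k := by
  classical
  unfold latticeBall
  rw [Finset.mem_filter, and_iff_right_iff_imp, Finset.mem_Icc]
  intro h
  have key : ∀ i, |n i| ≤ (k : ℤ) := fun i => by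
    have h1 : |(n i : ℝ)| ≤ latticeNorm n := by
      rw [← Real.sqrt_sq_eq_abs]
      exact Real.sqrt_le_sqrt
        (Finset.single_le_sum (f := fun i => (n i : ℝ) ^ 2) (fun _ _ => sq_nonneg _)
          (Finset.mem_univ i))
    exact_mod_cast h1.trans h
  exact ⟨fun i => (abs_le.1 (key i)).1, fun i => (abs_le.1 (key i)).2⟩

variable {E : Type*} [AddCommGroup E] [Module ℂ E] [TopologicalSpace E]

/-- The integrand `x ↦ f(x) e^{-i⟨n,x⟩}` of the `n`-th Fourier coefficient. -/
def fourierIntegrand (f : EuclideanSpace ℝ (Fin d) → E) (n : Fin d → ℤ) :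
    EuclideanSpace ℝ (Fin d) → E :=
  fun x => Complex.exp (-Complex.I * pairing n x) • f x

/-- The Fourier coefficient `(2π)^{-d} ∫_{[-π,π]ᵈ} f(x) e^{-i⟨n,x⟩} dx`, a Pettis integral for
Lebesgue measure. -/
def fourierCoeff (f : EuclideanSpace ℝ (Fin d) → E) (n : Fin d → ℤ) : E :=
  ((2 * Real.pi : ℂ) ^ d)⁻¹ • pettisIntegral (fourierIntegrand f n) (cube d) volume

lemma pairing_add_smul (n : Fin d → ℤ) (x : EuclideanSpace ℝ (Fin d)) (i : Fin d) (h c : ℝ) :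
    pairing n (x + h • EuclideanSpace.single i c) = pairing n x + h * (n i * c) := by
  simp [pairing, mul_add, Finset.sum_add_distrib]
  ring

lemma continuous_exp_pairing (n : Fin d → ℤ) :
    Continuous fun x : EuclideanSpace ℝ (Fin d) => Complex.exp (Complex.I * pairing n x) := by
  unfold pairing
  fun_prop

variable [T2Space E] [IsTopologicalAddGroup E] [ContinuousSMul ℂ E]

lemma hasPartialDerivAt_exp (n : Fin d → ℤ) (e : E) (i : Fin d) (x : EuclideanSpace ℝ (Fin d)) :
    HasPartialDerivAt i (fun x => Complex.exp (Complex.I * pairing n x) • e)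
      (Complex.exp (Complex.I * pairing n x) • (Complex.I * (n i : ℂ)) • e) x := by
  have h1 : HasDerivAt (fun h : ℝ => Complex.exp (Complex.I * (pairing n x + h * n i)))
      (Complex.exp (Complex.I * pairing n x) * (Complex.I * (n i : ℂ))) 0 := by
    have h2 : HasDerivAt (fun h : ℂ => Complex.exp (Complex.I * (pairing n x + h * n i)))
        (Complex.exp (Complex.I * (pairing n x + ((0 : ℝ) : ℂ) * n i)) *
          (Complex.I * (1 * (n i : ℂ)))) ((0 : ℝ) : ℂ) :=
      ((((hasDerivAt_id _).mul_const _).const_add _).const_mul _).cexp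
    simpa using h2.comp_ofReal
  have h3 := (hasDerivAt_iff_tendsto_slope_zero.1 h1).smul_const e
  rw [mul_smul] at h3
  refine h3.congr fun h => ?_
  change _ = h⁻¹ • (Complex.exp (Complex.I * pairing n (x + _)) • e -
    Complex.exp (Complex.I * pairing n x) • e)
  rw [pairing_add_smul, ← sub_smul, smul_assoc]
  simp

lemma isSmooth_exp (n : Fin d → ℤ) (e : E) :
    IsSmooth fun x : EuclideanSpace ℝ (Fin d) => Complex.exp (Complex.I * pairing n x) • e := by
  intro k
  induction k generalizing e with
  | zero => exact (continuous_exp_pairing n).smul continuous_const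
  | succ k ih =>
    intro i
    have h : partialDeriv i (fun x => Complex.exp (Complex.I * pairing n x) • e) =
        fun x => Complex.exp (Complex.I * pairing n x) • (Complex.I * (n i : ℂ)) • e :=
      funext fun x => (hasPartialDerivAt_exp n e i x).partialDeriv_eq
    rw [h]
    exact ⟨fun x => ⟨_, hasPartialDerivAt_exp n e i x⟩,
      (continuous_exp_pairing n).smul continuous_const, ih _⟩

/-- The element `x ↦ e^{i⟨n,x⟩} e` of `C^∞_{2π}(ℝᵈ, E)`. -/
def expTerm (n : Fin d → ℤ) (e : E) : periodicSmooth d E :=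
  ⟨⟨⟨fun x => Complex.exp (Complex.I * pairing n x) • e, isSmooth_exp n e⟩⟩, fun i x => by
    have h := pairing_add_smul n x i 1 (2 * Real.pi)
    rw [one_smul] at h
    change Complex.exp (Complex.I * pairing n (x + _)) • e = _
    rw [h]
    congr 1
    refine Complex.exp_eq_exp_iff_exists_int.2 ⟨n i, ?_⟩
    push_cast
    ring⟩

/-- The Fourier partial sum `∑_{|n| ≤ k} f̂(n) e^{i⟨n,·⟩}`, an element of `C^∞_{2π}(ℝᵈ, E)`. -/
def fourierPartialSum (k : ℕ) (f : periodicSmooth d E) : periodicSmooth d E :=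
  ∑ n ∈ latticeBall d k, expTerm n (fourierCoeff f n)

end Fourier

end

end SmoothFourier

/-! By Hahn–Banach, a continuous seminorm `p` is attained at any given vector by a functional
dominated by `p` (`exists_dual_norm_eq`). Testing `f` with functionals therefore reduces vector
identities and estimates to scalar Fourier analysis (`dual_fourierCoeff`). Only the existence of the
coefficients is genuinely vectorial.

Existence: a smooth periodic `f` is bounded and Lipschitz for every continuous seminorm. These
bounds define one closed disk `D` such that `f` is Lipschitz into `E_D`, which is a Banach space by
local completeness. The Bochner integral in `E_D` is the Pettis integral in `E`
(`pettisIntegrableOn_smul`).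

Convergence: `∂ᵢ` multiplies the `n`-th coefficient by `I * n i`, so the product of the operators `1
- ∂ᵢ²` multiplies it by `∏ (1 + n i ^ 2)`. Hence the coefficients are summable for every `p`
(`summable_seminorm_fourierCoeff`). The scalar theorem on the torus sums the series of `φ ∘ f`, and
a norming `φ` bounds the error of a finite sum by a tail of `∑ p (f̂ n)`, uniformly in `x`. Since
`∂^β` commutes with forming Fourier sums, the same holds for all derivatives, which is unconditional
convergence (`hasSum_expTerm_fourierCoeff`). The Schauder decomposition then follows from
orthogonality of the exponentials, continuity of each coefficient map, and the fact that the
Euclidean balls exhaust `ℤᵈ`. -/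

namespace SmoothFourier

open scoped Pointwise

/-! ### Periodic functions and the torus -/

section Torus

variable {d : ℕ} {F : Type*}

/-- `h` is `2π`-periodic in each variable. -/
def IsPeriodic (h : EuclideanSpace ℝ (Fin d) → F) : Prop :=
  ∀ i : Fin d, Function.Periodic h (EuclideanSpace.single i (2 * Real.pi))

lemma IsPeriodic.add_lattice {h : EuclideanSpace ℝ (Fin d) → F} (hh : IsPeriodic h)
    (x : EuclideanSpace ℝ (Fin d)) (z : Fin d → ℤ) :
    h (x + WithLp.toLp 2 fun i => 2 * Real.pi * z i) = h x := by
  have key : ∀ s : Finset (Fin d), ∀ x,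
      h (x + ∑ i ∈ s, z i • EuclideanSpace.single i (2 * Real.pi)) = h x := by
    intro s
    induction s using Finset.induction_on with
    | empty => simp
    | insert a s ha ih =>
      intro x
      rw [Finset.sum_insert ha, ← add_assoc, ih, (hh a).zsmul]
  rw [← key Finset.univ x]
  congr 2
  ext j
  simp [Pi.single_apply, mul_comm]

/-- A representative in the cube `(-π, π]ᵈ` of a point of the torus. -/
noncomputable def torusRep (t : UnitAddTorus (Fin d)) : EuclideanSpace ℝ (Fin d) :=
  WithLp.toLp 2 fun i => 2 * Real.pi * (AddCircle.equivIoc 1 (-(1 / 2) : ℝ) (t i) : ℝ)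

lemma torusRep_mem_cube (t : UnitAddTorus (Fin d)) : torusRep t ∈ cube d := by
  intro i
  have h := (AddCircle.equivIoc 1 (-(1 / 2) : ℝ) (t i)).2
  have hp := Real.pi_pos
  simp only [torusRep]
  constructor <;> nlinarith [h.1, h.2]

/-- The chosen representative differs from `2πy` by an element of `2πℤᵈ`, which `h` does not see. -/
lemma IsPeriodic.torusRep {h : EuclideanSpace ℝ (Fin d) → F} (hh : IsPeriodic h)
    (y : Fin d → ℝ) :
    h (torusRep fun i => (y i : UnitAddCircle)) = h (WithLp.toLp 2 fun i => 2 * Real.pi * y i) := by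
  have hy : ∀ i, ∃ z : ℤ, z • (1 : ℝ) =
      y i - (AddCircle.equivIoc 1 (-(1 / 2) : ℝ) (y i : UnitAddCircle) : ℝ) := fun i => by
    rw [← AddSubgroup.mem_zmultiples_iff, ← QuotientAddGroup.eq_iff_sub_mem]
    exact AddCircle.coe_equivIoc.symm
  choose z hz using hy
  rw [← hh.add_lattice _ z]
  congr 1
  ext i
  have := hz i
  simp only [zsmul_eq_mul, mul_one] at this
  simp [SmoothFourier.torusRep, this]
  ring

lemma IsPeriodic.exists_mem_cube {h : EuclideanSpace ℝ (Fin d) → F} (hh : IsPeriodic h)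
    (x : EuclideanSpace ℝ (Fin d)) : ∃ y ∈ cube d, h y = h x := by
  refine ⟨_, torusRep_mem_cube fun i => ((x i / (2 * Real.pi) : ℝ) : UnitAddCircle), ?_⟩
  rw [hh.torusRep]
  congr 1
  ext i
  simp only
  field_simp

/-- `torusRep` may jump at the boundary of the cell, so continuity is checked after pulling back
along the quotient map `ℝᵈ → 𝕋ᵈ`, where the choice of representative disappears. -/
lemma IsPeriodic.continuous_torus [TopologicalSpace F] {h : EuclideanSpace ℝ (Fin d) → F}
    (hh : IsPeriodic h) (hc : Continuous h) :
    Continuous fun t : UnitAddTorus (Fin d) => h (SmoothFourier.torusRep t) := by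
  have hq : IsOpenQuotientMap
      (Pi.map fun (_ : Fin d) (y : ℝ) => (y : UnitAddCircle)) :=
    IsOpenQuotientMap.piMap fun _ => QuotientAddGroup.isOpenQuotientMap_mk
  rw [hq.isQuotientMap.continuous_iff]
  have : ((fun t : UnitAddTorus (Fin d) => h (SmoothFourier.torusRep t)) ∘
      Pi.map fun (_ : Fin d) (y : ℝ) => (y : UnitAddCircle)) =
      fun y => h (WithLp.toLp 2 fun i => 2 * Real.pi * y i) := funext fun y => hh.torusRep y
  rw [this]
  fun_prop

lemma isCompact_cube (d : ℕ) : IsCompact (cube d) := by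
  have h := (isCompact_univ_pi fun _ : Fin d => isCompact_Icc (a := -Real.pi) (b := Real.pi)).image
    (PiLp.continuous_toLp 2 fun _ : Fin d => ℝ)
  convert h using 1
  ext x
  simp only [cube, Set.mem_image, Set.mem_pi, Set.mem_univ, true_imp_iff]
  exact ⟨fun hx => ⟨WithLp.ofLp x, hx, rfl⟩, fun ⟨y, hy, hyx⟩ => hyx ▸ hy⟩

variable [NormedAddCommGroup F] [NormedSpace ℝ F]

lemma integral_cube_eq (h : EuclideanSpace ℝ (Fin d) → F) :
    ∫ x in cube d, h x = (2 * Real.pi) ^ d •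
      ∫ y in {y : Fin d → ℝ | ∀ i, y i ∈ Set.Ioc (-(1 / 2) : ℝ) (-(1 / 2) + 1)},
        h (WithLp.toLp 2 fun i => 2 * Real.pi * y i) := by
  have hp := Real.pi_pos
  have h2p : (0 : ℝ) < 2 * Real.pi := by positivity
  have e1 := (PiLp.volume_preserving_toLp (Fin d)).setIntegral_preimage_emb
    (MeasurableEquiv.toLp 2 (Fin d → ℝ)).measurableEmbedding h (cube d)
  have e2 := Measure.setIntegral_comp_smul_of_pos (volume : Measure (Fin d → ℝ))
    (fun y => h (WithLp.toLp 2 y))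
    {y : Fin d → ℝ | ∀ i, y i ∈ Set.Ioc (-(1 / 2) : ℝ) (-(1 / 2) + 1)} h2p
  have e3 : ∀ y : Fin d → ℝ, (2 * Real.pi) • y = fun i => 2 * Real.pi * y i := fun y => rfl
  simp only [e3] at e2
  rw [e2, Module.finrank_fin_fun, smul_smul, mul_inv_cancel₀ (by positivity), one_smul, ← e1]
  refine setIntegral_congr_set ?_
  have e4 : (2 * Real.pi) • {y : Fin d → ℝ | ∀ i, y i ∈ Set.Ioc (-(1 / 2) : ℝ) (-(1 / 2) + 1)} =
      Set.univ.pi fun _ : Fin d => Set.Ioc (-Real.pi) Real.pi := by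
    ext y
    simp only [Set.mem_smul_set_iff_inv_smul_mem₀ h2p.ne', Set.mem_ofPred_eq, Set.mem_pi,
      Set.mem_univ, true_imp_iff, Pi.smul_apply, smul_eq_mul, Set.mem_Ioc]
    refine forall_congr' fun i => ?_
    rw [← div_eq_inv_mul, lt_div_iff₀ h2p, div_le_iff₀ h2p]
    constructor <;> rintro ⟨h1, h2⟩ <;> constructor <;> linarith
  rw [e4]
  -- The closed cube and the half-open cell used on the torus differ by a null set.
  refine EventuallyEq.trans ?_ (Measure.univ_pi_Ioc_ae_eq_Icc (μ := fun _ : Fin d => volume)).symm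
  refine Eq.eventuallyEq ?_
  ext y
  change (∀ i, _ ∧ _) ↔ (∀ i, _) ∧ ∀ i, _
  exact forall_and

/-- The unit cell may start at any corner `a`, because the integral over each such cell equals the
integral over the torus. -/
lemma IsPeriodic.integral_cube_eq {h : EuclideanSpace ℝ (Fin d) → F} (hh : IsPeriodic h)
    (a : Fin d → ℝ) :
    ∫ x in cube d, h x = (2 * Real.pi) ^ d •
      ∫ y in {y : Fin d → ℝ | ∀ i, y i ∈ Set.Ioc (a i) (a i + 1)},
        h (WithLp.toLp 2 fun i => 2 * Real.pi * y i) := by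
  rw [SmoothFourier.integral_cube_eq]
  have e := (UnitAddTorus.integral_preimage (fun t => h (SmoothFourier.torusRep t))
    fun _ : Fin d => (-(1 / 2) : ℝ)).symm.trans
      (UnitAddTorus.integral_preimage (fun t => h (SmoothFourier.torusRep t)) a)
  simp only [hh.torusRep] at e
  rw [e]

lemma IsPeriodic.comp_add {h : EuclideanSpace ℝ (Fin d) → F} (hh : IsPeriodic h)
    (s : EuclideanSpace ℝ (Fin d)) : IsPeriodic fun x => h (x + s) := fun i x => by
  change h (x + _ + s) = _
  rw [add_right_comm, hh i]

/-- The integral of a periodic function over the cube is translation invariant. -/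
lemma IsPeriodic.integral_cube_comp_add {h : EuclideanSpace ℝ (Fin d) → F} (hh : IsPeriodic h)
    (s : EuclideanSpace ℝ (Fin d)) : ∫ x in cube d, h (x + s) = ∫ x in cube d, h x := by
  -- After rescaling by `2π`, translation by `s` carries the cell at `0` to the cell at `s / (2π)`,
  -- so the two corners are chosen accordingly.
  rw [(hh.comp_add s).integral_cube_eq 0, hh.integral_cube_eq fun i => s i / (2 * Real.pi)]
  congr 1
  have e : (fun y : Fin d → ℝ => y + fun i => s i / (2 * Real.pi)) ⁻¹'
      {y | ∀ i, y i ∈ Set.Ioc (s i / (2 * Real.pi)) (s i / (2 * Real.pi) + 1)} =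
      {y | ∀ i, y i ∈ Set.Ioc ((0 : Fin d → ℝ) i) ((0 : Fin d → ℝ) i + 1)} := by
    ext y
    simp [add_comm]
  rw [← (measurePreserving_add_right (volume : Measure (Fin d → ℝ))
    fun i => s i / (2 * Real.pi)).setIntegral_preimage_emb (measurableEmbedding_addRight _)
      (fun y => h (WithLp.toLp 2 fun i => 2 * Real.pi * y i)), e]
  congr 1
  funext y
  congr 1
  ext i
  have := Real.pi_pos
  simp only [PiLp.add_apply, Pi.add_apply]
  field_simp

lemma integrableOn_cube {h : EuclideanSpace ℝ (Fin d) → F} (hc : Continuous h) :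
    IntegrableOn h (cube d) := hc.continuousOn.integrableOn_compact (isCompact_cube d)

end Torus

/-! ### Fourier coefficients of scalar functions -/

section Scalar

variable {d : ℕ}

lemma IsPeriodic.exists_bound {h : EuclideanSpace ℝ (Fin d) → ℝ} (hh : IsPeriodic h)
    (hc : Continuous h) : ∃ C, ∀ x, h x ≤ C := by
  obtain ⟨C, hC⟩ := ((isCompact_cube d).image hc).bddAbove
  refine ⟨C, fun x => ?_⟩
  obtain ⟨y, hy, hyx⟩ := hh.exists_mem_cube x
  exact hyx ▸ hC ⟨y, hy, rfl⟩

lemma HasPartialDerivAt.hasDerivAt {i : Fin d} {h : EuclideanSpace ℝ (Fin d) → ℂ} {e : ℂ}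
    {x : EuclideanSpace ℝ (Fin d)} {s : ℝ}
    (hh : HasPartialDerivAt i h e (x + s • EuclideanSpace.single i (1 : ℝ))) :
    HasDerivAt (fun r : ℝ => h (x + r • EuclideanSpace.single i (1 : ℝ))) e s := by
  rw [hasDerivAt_iff_tendsto_slope_zero]
  refine hh.congr fun r => ?_
  rw [add_smul, add_assoc]

/-- By translation invariance the integral of `h (x + s eᵢ)` over the cube is constant in `s`.
Differentiating under the integral at `s = 0` gives the claim without boundary terms. -/
lemma integral_cube_partialDeriv {i : Fin d} {h h' : EuclideanSpace ℝ (Fin d) → ℂ}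
    (hh : IsPeriodic h) (hh' : IsPeriodic h') (hc : Continuous h) (hc' : Continuous h')
    (hd : ∀ x, HasPartialDerivAt i h (h' x) x) : ∫ x in cube d, h' x = 0 := by
  obtain ⟨C, hC⟩ := IsPeriodic.exists_bound (h := fun x => ‖h' x‖)
    (fun j x => by simp only [hh' j x]) hc'.norm
  have key := (hasDerivAt_integral_of_dominated_loc_of_deriv_le (μ := volume.restrict (cube d))
    (F := fun (s : ℝ) x => h (x + s • EuclideanSpace.single i (1 : ℝ)))
    (F' := fun (s : ℝ) x => h' (x + s • EuclideanSpace.single i (1 : ℝ)))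
    (x₀ := 0) (s := Set.univ) (bound := fun _ => C) univ_mem
    (.of_forall fun s => (by fun_prop : Continuous _).aestronglyMeasurable)
    (integrableOn_cube (by fun_prop)) (by fun_prop : Continuous _).aestronglyMeasurable
    (.of_forall fun x s _ => hC _) (integrableOn_cube continuous_const)
    (.of_forall fun x s _ => (hd _).hasDerivAt)).2
  simp only [hh.integral_cube_comp_add, hh'.integral_cube_comp_add] at key
  exact key.unique (hasDerivAt_const _ _)

lemma isPeriodic_exp (n : Fin d → ℤ) :
    IsPeriodic fun x : EuclideanSpace ℝ (Fin d) => Complex.exp (Complex.I * pairing n x) := by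
  intro i x
  have h := (expTerm n (1 : ℂ)).2 i x
  change _ • (1 : ℂ) = _ • (1 : ℂ) at h
  simpa using h

lemma pairing_neg (n : Fin d → ℤ) (x : EuclideanSpace ℝ (Fin d)) :
    pairing (-n) x = -pairing n x := by simp [pairing]

lemma exp_neg_pairing (n : Fin d → ℤ) (x : EuclideanSpace ℝ (Fin d)) :
    Complex.exp (-Complex.I * pairing n x) = Complex.exp (Complex.I * pairing (-n) x) := by
  rw [pairing_neg]
  congr 1
  push_cast
  ring

lemma volume_real_cube (d : ℕ) : volume.real (cube d) = (2 * Real.pi) ^ d := by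
  have h := integral_cube_eq (d := d) (fun _ => (1 : ℝ))
  have hset : {y : Fin d → ℝ | ∀ i, y i ∈ Set.Ioc (-(1 / 2) : ℝ) (-(1 / 2) + 1)} =
      Set.univ.pi fun _ => Set.Ioc (-(1 / 2) : ℝ) (-(1 / 2) + 1) := by ext; simp
  have hv : volume.real {y : Fin d → ℝ | ∀ i, y i ∈ Set.Ioc (-(1 / 2) : ℝ) (-(1 / 2) + 1)} = 1 := by
    rw [hset, Measure.real, Real.volume_pi_Ioc]
    simp
  rwa [setIntegral_const, setIntegral_const, hv, smul_eq_mul, one_smul, smul_eq_mul, mul_one,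
    mul_one] at h

/-- The Fourier coefficient of a scalar function, as an ordinary integral. -/
noncomputable def scalarCoeff (h : EuclideanSpace ℝ (Fin d) → ℂ) (n : Fin d → ℤ) : ℂ :=
  ((2 * Real.pi : ℂ) ^ d)⁻¹ * ∫ x in cube d, Complex.exp (-Complex.I * pairing n x) * h x

lemma HasPartialDerivAt.exp_mul {i : Fin d} {h : EuclideanSpace ℝ (Fin d) → ℂ} {e : ℂ}
    {x : EuclideanSpace ℝ (Fin d)} (n : Fin d → ℤ) (hh : HasPartialDerivAt i h e x) :
    HasPartialDerivAt i (fun x => Complex.exp (Complex.I * pairing n x) * h x)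
      (Complex.exp (Complex.I * pairing n x) * (Complex.I * n i * h x + e)) x := by
  have h1 : HasDerivAt (fun r : ℝ => h (x + r • EuclideanSpace.single i (1 : ℝ))) e 0 :=
    HasPartialDerivAt.hasDerivAt (by simpa using hh)
  have h2 : HasDerivAt (fun r : ℝ => Complex.exp (Complex.I *
      pairing n (x + r • EuclideanSpace.single i (1 : ℝ))))
      (Complex.exp (Complex.I * pairing n x) * (Complex.I * n i)) 0 :=
    HasPartialDerivAt.hasDerivAt
      (h := fun x => Complex.exp (Complex.I * pairing n x))
      (by simpa using hasPartialDerivAt_exp n (1 : ℂ) i x)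
  have h3 := hasDerivAt_iff_tendsto_slope_zero.1 (h2.mul h1)
  simp only [zero_smul, add_zero, zero_add, Pi.mul_apply] at h3
  rw [mul_add, ← mul_assoc]
  exact h3

/-- This is integration by parts: the partial derivative of the periodic product `e^{-i⟨n,x⟩} h(x)`
has integral zero. -/
lemma scalarCoeff_partialDeriv {i : Fin d} {h h' : EuclideanSpace ℝ (Fin d) → ℂ}
    (hh : IsPeriodic h) (hh' : IsPeriodic h') (hc : Continuous h) (hc' : Continuous h')
    (hd : ∀ x, HasPartialDerivAt i h (h' x) x) (n : Fin d → ℤ) :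
    scalarCoeff h' n = Complex.I * n i * scalarCoeff h n := by
  have hexp := continuous_exp_pairing (-n)
  have key := integral_cube_partialDeriv (i := i)
    (h := fun x => Complex.exp (Complex.I * pairing (-n) x) * h x)
    (h' := fun x => Complex.exp (Complex.I * pairing (-n) x) *
      (Complex.I * (-n) i * h x + h' x))
    (fun j x => by simp only [isPeriodic_exp (-n) j x, hh j x])
    (fun j x => by simp only [isPeriodic_exp (-n) j x, hh j x, hh' j x])
    (by fun_prop) (by fun_prop) (fun x => by simpa using (hd x).exp_mul (-n))
  have e : ∀ x, Complex.exp (Complex.I * pairing (-n) x) * (Complex.I * (-n) i * h x + h' x) =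
      Complex.exp (Complex.I * pairing (-n) x) * h' x -
        Complex.I * n i * (Complex.exp (Complex.I * pairing (-n) x) * h x) := fun x => by
    rw [Pi.neg_apply]
    push_cast
    ring
  simp only [e] at key
  rw [integral_sub (integrableOn_cube (by fun_prop)) (integrableOn_cube (by fun_prop)),
    integral_const_mul, sub_eq_zero] at key
  simp only [scalarCoeff, exp_neg_pairing, key]
  ring

lemma scalarCoeff_const_mul (c : ℂ) (h : EuclideanSpace ℝ (Fin d) → ℂ) (n : Fin d → ℤ) :
    scalarCoeff (fun x => c * h x) n = c * scalarCoeff h n := by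
  simp only [scalarCoeff]
  rw [mul_left_comm, ← integral_const_mul c]
  simp only [mul_left_comm]

/-- If `n i ≠ m i`, computing the coefficient of the `i`-th partial derivative in two ways
multiplies the same number by `I * m i` and by `I * n i`, so it vanishes. -/
lemma scalarCoeff_exp (m n : Fin d → ℤ) :
    scalarCoeff (fun x => Complex.exp (Complex.I * pairing m x)) n = if n = m then 1 else 0 := by
  split_ifs with hnm
  · subst hnm
    have e : ∀ x, Complex.exp (-Complex.I * pairing n x) * Complex.exp (Complex.I * pairing n x) =
        1 := fun x => by rw [← Complex.exp_add]; simp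
    simp only [scalarCoeff, e]
    rw [setIntegral_const, volume_real_cube]
    have := Real.pi_ne_zero
    simp only [Complex.real_smul, Complex.ofReal_pow, Complex.ofReal_mul, Complex.ofReal_ofNat,
      mul_one]
    exact inv_mul_cancel₀ (by simp [this])
  · obtain ⟨i, hi⟩ := Function.ne_iff.1 hnm
    have hc := continuous_exp_pairing m
    have key := scalarCoeff_partialDeriv (i := i)
      (h := fun x => Complex.exp (Complex.I * pairing m x))
      (h' := fun x => Complex.I * m i * Complex.exp (Complex.I * pairing m x))
      (isPeriodic_exp m) (fun j x => by simp only [isPeriodic_exp m j x]) hc (by fun_prop)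
      (fun x => by simpa [mul_comm] using hasPartialDerivAt_exp m (1 : ℂ) i x) n
    rw [scalarCoeff_const_mul, ← sub_eq_zero, ← sub_mul, mul_eq_zero] at key
    refine key.resolve_left ?_
    rw [← mul_sub, mul_eq_zero, not_or, sub_eq_zero]
    exact ⟨Complex.I_ne_zero, by exact_mod_cast Ne.symm hi⟩

lemma scalarCoeff_add {g h : EuclideanSpace ℝ (Fin d) → ℂ} (hg : Continuous g)
    (hh : Continuous h) (n : Fin d → ℤ) :
    scalarCoeff (fun x => g x + h x) n = scalarCoeff g n + scalarCoeff h n := by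
  have hexp := continuous_exp_pairing (-n)
  simp only [scalarCoeff, exp_neg_pairing, mul_add]
  rw [integral_add (integrableOn_cube (by fun_prop)) (integrableOn_cube (by fun_prop)), mul_add]

lemma norm_scalarCoeff_le {h : EuclideanSpace ℝ (Fin d) → ℂ} {C : ℝ}
    (hC : ∀ x ∈ cube d, ‖h x‖ ≤ C) (n : Fin d → ℤ) : ‖scalarCoeff h n‖ ≤ C := by
  have h1 := norm_setIntegral_le_of_norm_le_const (μ := volume) (C := C)
    (isCompact_cube d).measure_lt_top
    (f := fun x => Complex.exp (-Complex.I * pairing n x) * h x) fun x hx => by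
      rw [norm_mul, exp_neg_pairing, mul_comm Complex.I, Complex.norm_exp_ofReal_mul_I, one_mul]
      exact hC x hx
  have hp : (0 : ℝ) < (2 * Real.pi) ^ d := by positivity
  rw [volume_real_cube] at h1
  have h2 : ‖((2 * Real.pi : ℂ) ^ d)⁻¹‖ = ((2 * Real.pi) ^ d)⁻¹ := by
    simp [abs_of_pos Real.pi_pos]
  rw [scalarCoeff, norm_mul, h2, inv_mul_le_iff₀ hp, mul_comm]
  exact h1

lemma mFourier_coe (n : Fin d → ℤ) (y : Fin d → ℝ) :
    UnitAddTorus.mFourier n (fun i => (y i : UnitAddCircle)) =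
      Complex.exp (Complex.I * pairing n (WithLp.toLp 2 fun i => 2 * Real.pi * y i)) := by
  simp only [UnitAddTorus.mFourier, ContinuousMap.coe_mk, fourier_coe_apply, ← Complex.exp_sum,
    pairing]
  congr 1
  push_cast
  rw [Finset.mul_sum]
  exact Finset.sum_congr rfl fun i _ => by ring

/-- The factor `(2π)^d` from rescaling the cube to the unit torus cancels the normalization of
`scalarCoeff`. -/
lemma IsPeriodic.mFourierCoeff_torusRep {h : EuclideanSpace ℝ (Fin d) → ℂ} (hh : IsPeriodic h)
    (n : Fin d → ℤ) :
    UnitAddTorus.mFourierCoeff (fun t => h (SmoothFourier.torusRep t)) n = scalarCoeff h n := by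
  rw [UnitAddTorus.mFourierCoeff_eq_integral _ _ fun _ => (-(1 / 2) : ℝ), scalarCoeff,
    SmoothFourier.integral_cube_eq]
  simp only [hh.torusRep, mFourier_coe, exp_neg_pairing, smul_eq_mul, Complex.real_smul]
  rw [← mul_assoc]
  have := Real.pi_ne_zero
  push_cast
  rw [inv_mul_cancel₀ (by simp [this]), one_mul]

/-- A continuous periodic scalar function with summable Fourier coefficients is the sum of its
Fourier series. -/
lemma IsPeriodic.hasSum_scalarCoeff {h : EuclideanSpace ℝ (Fin d) → ℂ} (hh : IsPeriodic h)
    (hc : Continuous h) (hs : Summable (scalarCoeff h)) (x : EuclideanSpace ℝ (Fin d)) :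
    HasSum (fun n => Complex.exp (Complex.I * pairing n x) * scalarCoeff h n) (h x) := by
  let g : C(UnitAddTorus (Fin d), ℂ) := ⟨_, hh.continuous_torus hc⟩
  have hg : ∀ n, UnitAddTorus.mFourierCoeff g n = scalarCoeff h n := hh.mFourierCoeff_torusRep
  have key := UnitAddTorus.hasSum_mFourier_series_apply_of_summable (f := g)
    (by rwa [funext hg]) fun i => ((x i / (2 * Real.pi) : ℝ) : UnitAddCircle)
  have hx : (WithLp.toLp 2 fun i => 2 * Real.pi * (x i / (2 * Real.pi))) = x := by
    ext i
    simp only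
    field_simp
  have hgx : g (fun i => ((x i / (2 * Real.pi) : ℝ) : UnitAddCircle)) = h x := by
    change h (SmoothFourier.torusRep _) = _
    rw [hh.torusRep, hx]
  simp only [hg, hgx, mFourier_coe, hx, smul_eq_mul] at key
  simpa only [mul_comm] using key

end Scalar

/-! ### Hahn–Banach in complex locally convex spaces -/

section Dual

universe u

variable {E : Type u} [AddCommGroup E] [Module ℂ E] [TopologicalSpace E] [IsTopologicalAddGroup E]
  [ContinuousSMul ℂ E] [LocallyConvexSpace ℝ E]

/-- Convexity over the ordered scalars `ℂ` involves only nonnegative scalars, and these are real.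
Real local convexity thus provides enough continuous complex seminorms. -/
instance polynormableSpace_of_locallyConvexSpace_real : PolynormableSpace ℂ E := by
  open scoped ComplexOrder in
  have : LocallyConvexSpace ℂ E := ⟨fun x => by
    refine (LocallyConvexSpace.convex_basis (𝕜 := ℝ) x).to_hasBasis
      (fun s hs => ⟨s, ⟨hs.1, ?_⟩, le_rfl⟩) fun s hs => ⟨s, ⟨hs.1, hs.2.lift ℝ⟩, le_rfl⟩
    exact convex_of_nonneg_surjective_algebraMap _
      (fun _ hy => RCLike.nonneg_iff_exists_ofReal.mp hy) hs.2⟩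
  have : ContinuousSMul ℝ E := IsScalarTower.continuousSMul ℂ
  exact LocallyConvexSpace.toPolynormableSpace

/-- For a continuous seminorm `p` and a vector `x` there is a continuous functional dominated by `p`
that attains `p x` at `x`. -/
lemma exists_dual_norm_eq {p : Seminorm ℂ E} (hp : Continuous p) (x : E) :
    ∃ φ : E →L[ℂ] ℂ, ‖φ x‖ = p x ∧ ∀ y, ‖φ y‖ ≤ p y := by
  rcases eq_or_ne x 0 with rfl | hx
  · exact ⟨0, by simp, fun y => by simp⟩
  let e := LinearEquiv.toSpanNonzeroSingleton ℂ E x hx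
  have he : ∀ y : Submodule.span ℂ {x}, e.symm y • x = y := fun y =>
    congrArg Subtype.val (e.apply_symm_apply y)
  -- The functional `λ x ↦ λ p(x)` on the line through `x` satisfies the bound by `p` with equality,
  -- and it is extended to all of `E`.
  obtain ⟨φ, h1, h2⟩ := Module.Dual.exists_continuous_extension_of_le_seminorm
    (Submodule.span ℂ {x}) ((p x : ℂ) • (e.symm : Submodule.span ℂ {x} →ₗ[ℂ] ℂ)) hp fun y => by
      rw [← he y, map_smul_eq_mul]
      simp [mul_comm, abs_of_nonneg (apply_nonneg p x)]
  refine ⟨φ, ?_, h2⟩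
  have h3 := h1 (e 1)
  have h4 : (e 1 : E) = x := by
    rw [← he]
    simp
  rw [h4] at h3
  rw [h3]
  simp [abs_of_nonneg (apply_nonneg p x)]

lemma eq_zero_of_seminorm [T2Space E] {x : E} (h : ∀ p : Seminorm ℂ E, Continuous p → p x = 0) :
    x = 0 := by
  by_contra hx
  obtain ⟨p, hp⟩ := (PolynormableSpace.withSeminorms ℂ E).separating_of_T1 x hx
  exact hp (h p.1 p.2)

lemma eq_of_forall_dual [T2Space E] {x y : E} (h : ∀ φ : E →L[ℂ] ℂ, φ x = φ y) : x = y := by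
  rw [← sub_eq_zero]
  refine eq_zero_of_seminorm fun p hp => ?_
  obtain ⟨φ, hφ, -⟩ := exists_dual_norm_eq hp (x - y)
  rw [← hφ, map_sub, h, sub_self, norm_zero]

/-! ### The Banach space of a disk -/

/-- The disk of the vectors `y` with `p y ≤ M p` for every continuous seminorm `p`. -/
def seminormDisk (M : {p : Seminorm ℂ E // Continuous p} → ℝ) : Set E := {y | ∀ p, p.1 y ≤ M p}

variable {M : {p : Seminorm ℂ E // Continuous p} → ℝ}

lemma isDisk_seminormDisk : IsDisk E (seminormDisk M) := by
  refine ⟨?_, ?_, ?_⟩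
  · rw [(PolynormableSpace.withSeminorms ℂ E).isVonNBounded_iff_seminorm_bounded]
    intro p
    refine ⟨|M p| + 1, by positivity, fun x hx => ?_⟩
    have := hx p
    have := le_abs_self (M p)
    linarith
  · rw [balanced_iff_smul_mem]
    intro a ha x hx p
    rw [map_smul_eq_mul]
    exact (mul_le_of_le_one_left (apply_nonneg _ _) ha).trans (hx p)
  · have : seminormDisk M =
        ⋂ p : {p : Seminorm ℂ E // Continuous p}, p.1.closedBall 0 (M p) := by
      ext y
      simp [seminormDisk, Seminorm.mem_closedBall]
    rw [this]
    exact convex_iInter fun p => p.1.convex_closedBall _ _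

lemma isClosed_seminormDisk : IsClosed (seminormDisk M) := by
  simp only [seminormDisk, Set.ofPred_forall]
  exact isClosed_iInter fun p : {p : Seminorm ℂ E // Continuous p} =>
    isClosed_le p.2 continuous_const

/-- The linear span of `seminormDisk M`. -/
def diskSubmodule (M : {p : Seminorm ℂ E // Continuous p} → ℝ) : Submodule ℂ E where
  carrier := {y | ∃ r : ℝ, 0 ≤ r ∧ ∀ p, p.1 y ≤ r * M p}
  add_mem' := by
    rintro a b ⟨r, hr, ha⟩ ⟨s, hs, hb⟩
    exact ⟨r + s, add_nonneg hr hs, fun p => (map_add_le_add p.1 a b).trans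
      (by rw [add_mul]; exact add_le_add (ha p) (hb p))⟩
  zero_mem' := ⟨0, le_rfl, fun p => by simp⟩
  smul_mem' := by
    rintro c a ⟨r, hr, ha⟩
    exact ⟨‖c‖ * r, by positivity, fun p => by
      rw [map_smul_eq_mul, mul_assoc]
      exact mul_le_mul_of_nonneg_left (ha p) (norm_nonneg c)⟩

/-- The space `diskSubmodule M` as a type of its own, which carries the norm of the disk. -/
def DiskSpace (M : {p : Seminorm ℂ E // Continuous p} → ℝ) : Type u := diskSubmodule M

namespace DiskSpace

instance : AddCommGroup (DiskSpace M) := inferInstanceAs (AddCommGroup (diskSubmodule M))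

instance : Module ℂ (DiskSpace M) := inferInstanceAs (Module ℂ (diskSubmodule M))

/-- The inclusion into the ambient space. -/
def incl (M : {p : Seminorm ℂ E // Continuous p} → ℝ) : DiskSpace M →ₗ[ℂ] E :=
  (diskSubmodule M).subtype

lemma incl_injective : Function.Injective (incl M) := Subtype.val_injective

/-- For `M ≥ 0` this is the gauge of the disk. In this form, with radius `0` allowed, the admissible
radii form a closed set and the infimum is attained (`norm_mem`). -/
noncomputable instance : Norm (DiskSpace M) :=
  ⟨fun y => sInf {r : ℝ | 0 ≤ r ∧ ∀ p, p.1 (incl M y) ≤ r * M p}⟩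

lemma norm_mem (y : DiskSpace M) : 0 ≤ ‖y‖ ∧ ∀ p, p.1 (incl M y) ≤ ‖y‖ * M p := by
  have hcl : IsClosed {r : ℝ | 0 ≤ r ∧ ∀ p, p.1 (incl M y) ≤ r * M p} := by
    simp only [Set.ofPred_and, Set.ofPred_forall]
    exact (isClosed_le continuous_const continuous_id).inter
      (isClosed_iInter fun p => isClosed_le continuous_const (continuous_id.mul continuous_const))
  exact hcl.csInf_mem y.2 ⟨0, fun r hr => hr.1⟩

lemma norm_le {y : DiskSpace M} {r : ℝ} (hr : 0 ≤ r) (h : ∀ p, p.1 (incl M y) ≤ r * M p) :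
    ‖y‖ ≤ r := csInf_le ⟨0, fun _ hs => hs.1⟩ ⟨hr, h⟩

/-- The norm of `DiskSpace M`, as a seminorm. -/
noncomputable def seminorm (M : {p : Seminorm ℂ E // Continuous p} → ℝ) :
    Seminorm ℂ (DiskSpace M) :=
  Seminorm.ofSMulLE (fun y => ‖y‖)
    (le_antisymm (norm_le le_rfl fun p => by simp) (norm_mem _).1)
    (fun x y => norm_le (add_nonneg (norm_mem x).1 (norm_mem y).1) fun p => by
      rw [map_add, add_mul]
      exact (map_add_le_add p.1 _ _).trans (add_le_add ((norm_mem x).2 p) ((norm_mem y).2 p)))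
    (fun c x => norm_le (mul_nonneg (norm_nonneg c) (norm_mem x).1) fun p => by
      rw [map_smul, map_smul_eq_mul, mul_assoc]
      exact mul_le_mul_of_nonneg_left ((norm_mem x).2 p) (norm_nonneg c))

variable [T2Space E]

lemma core : NormedSpace.Core ℂ (DiskSpace M) where
  norm_nonneg x := (norm_mem x).1
  norm_smul c x := map_smul_eq_mul (seminorm M) c x
  norm_triangle x y := map_add_le_add (seminorm M) x y
  norm_eq_zero_iff x := by
    refine ⟨fun h => incl_injective ?_, fun h => ?_⟩
    · rw [map_zero]
      refine eq_zero_of_seminorm fun p hp => le_antisymm ?_ (apply_nonneg _ _)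
      simpa [h] using (norm_mem x).2 ⟨p, hp⟩
    · rw [h]
      exact map_zero (seminorm M)

noncomputable instance : NormedAddCommGroup (DiskSpace M) := NormedAddCommGroup.ofCore core

noncomputable instance : NormedSpace ℂ (DiskSpace M) := NormedSpace.ofCore core

lemma mem_smul_disk {y : E} {r : ℝ} (hr : 0 < r) :
    y ∈ r • seminormDisk M ↔ ∀ p, p.1 y ≤ r * M p := by
  rw [Set.mem_smul_set_iff_inv_smul_mem₀ hr.ne']
  refine forall_congr' fun p => ?_
  have h : p.1 (r⁻¹ • y) = r⁻¹ * p.1 y := by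
    rw [← Complex.coe_smul, map_smul_eq_mul]
    simp [abs_of_pos hr]
  rw [h, inv_mul_le_iff₀ hr]

lemma diskSpan_eq (hM : ∀ p, 0 ≤ M p) : diskSpan (seminormDisk M) = diskSubmodule M := by
  ext y
  simp only [diskSpan, Set.mem_iUnion, Set.mem_image]
  constructor
  · rintro ⟨n, z, hz, rfl⟩
    exact ⟨n, n.cast_nonneg, fun p => by
      rw [map_smul_eq_mul]
      simpa using mul_le_mul_of_nonneg_left (hz p) n.cast_nonneg⟩
  · rintro ⟨r, hr, hy⟩
    -- The summand `1` makes `n` positive even for `r = 0`, so that dividing by `n` is possible.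
    obtain ⟨n, hn⟩ := exists_nat_ge (r + 1)
    have hn0 : (0 : ℝ) < n := by linarith
    have hmem := (mem_smul_disk hn0).2 fun p =>
      (hy p).trans (mul_le_mul_of_nonneg_right (by linarith) (hM p))
    obtain ⟨z, hz, hzy⟩ := hmem
    refine ⟨n, z, hz, ?_⟩
    rw [← hzy]
    change (n : ℂ) • z = (n : ℝ) • z
    rw [← Complex.coe_smul, Complex.ofReal_natCast]

lemma norm_le_gauge (hM : ∀ p, 0 ≤ M p) (y : DiskSpace M) :
    ‖y‖ ≤ gauge (seminormDisk M) (incl M y) := by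
  -- The radius `‖y‖ + 1` only shows that the set in the gauge is nonempty; the gauge admits
  -- positive radii only.
  refine le_csInf ⟨‖y‖ + 1, ?_, ?_⟩ fun r hr =>
    norm_le (le_of_lt hr.1) ((mem_smul_disk hr.1).1 hr.2)
  · exact add_pos_of_nonneg_of_pos (norm_mem y).1 one_pos
  · exact (mem_smul_disk (add_pos_of_nonneg_of_pos (norm_mem y).1 one_pos)).2 fun p =>
      ((norm_mem y).2 p).trans (mul_le_mul_of_nonneg_right (by linarith) (hM p))

lemma gauge_le (hM : ∀ p, 0 ≤ M p) {y : DiskSpace M} {r : ℝ} (hr : 0 < r) (hy : ‖y‖ ≤ r) :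
    gauge (seminormDisk M) (incl M y) ≤ r :=
  gauge_le_of_mem hr.le ((mem_smul_disk hr).2 fun p =>
    ((norm_mem y).2 p).trans (mul_le_mul_of_nonneg_right hy (hM p)))

/-- Local completeness is phrased with gauges of vectors of `E`. The comparisons `gauge_le` and
`norm_le_gauge` carry the Cauchy condition there and the limit back. -/
lemma completeSpace (hE : IsLocallyComplete E) (hM : ∀ p, 0 ≤ M p) :
    CompleteSpace (DiskSpace M) := by
  refine Metric.complete_of_cauchySeq_tendsto fun u hu => ?_
  have hmem : ∀ y : DiskSpace M, incl M y ∈ diskSpan (seminormDisk M) := fun y => by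
    rw [diskSpan_eq hM]
    exact y.2
  obtain ⟨x, hx, hlim⟩ := hE _ isDisk_seminormDisk isClosed_seminormDisk (fun k => incl M (u k))
    (fun k => hmem _) fun ε hε => by
      obtain ⟨N, hN⟩ := Metric.cauchySeq_iff.1 hu (ε / 2) (by positivity)
      refine ⟨N, fun m hm k hk => ?_⟩
      have h := hN m hm k hk
      rw [dist_eq_norm] at h
      rw [← map_sub]
      exact (gauge_le hM (by positivity) h.le).trans_lt (by linarith)
  rw [diskSpan_eq hM] at hx
  let x' : DiskSpace M := ⟨x, hx⟩
  refine ⟨x', tendsto_iff_norm_sub_tendsto_zero.2 (squeeze_zero (fun _ => norm_nonneg _)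
    (fun k => ?_) hlim)⟩
  have h := norm_le_gauge hM (u k - x')
  rwa [map_sub] at h

/-- A continuous functional of the ambient space, restricted to the Banach space of a disk. -/
noncomputable def restrictDual (φ : E →L[ℂ] ℂ) (M : {p : Seminorm ℂ E // Continuous p} → ℝ) :
    DiskSpace M →L[ℂ] ℂ :=
  (φ.toLinearMap ∘ₗ incl M).mkContinuous (M ⟨φ.toSeminorm, φ.continuous.norm⟩) fun y => by
    rw [mul_comm]
    exact (norm_mem y).2 ⟨φ.toSeminorm, φ.continuous.norm⟩

end DiskSpace

/-! ### Pettis integrability of Lipschitz functions -/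

variable [T2Space E]

/-- In a locally complete space, the product of a continuous scalar function and a bounded Lipschitz
function is Pettis-integrable over compact sets. -/
lemma pettisIntegrableOn_smul {X : Type*} [NormedAddCommGroup X] [MeasurableSpace X]
    [OpensMeasurableSpace X] [SecondCountableTopology X]
    {μ : Measure X} [IsFiniteMeasureOnCompacts μ] {K : Set X} (hK : IsCompact K)
    (hE : IsLocallyComplete E) {f : X → E} {c : X → ℂ} (hc : Continuous c)
    (hb : ∀ p : Seminorm ℂ E, Continuous p → ∃ C, ∀ x, p (f x) ≤ C)
    (hl : ∀ p : Seminorm ℂ E, Continuous p → ∃ C, ∀ x y, p (f x - f y) ≤ C * ‖x - y‖) :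
    PettisIntegrableOn (fun x => c x • f x) K μ := by
  choose B hB using fun p : {p : Seminorm ℂ E // Continuous p} => hb p.1 p.2
  choose L hL using fun p : {p : Seminorm ℂ E // Continuous p} => hl p.1 p.2
  -- The summand `|B p|` puts the values of `f` into the disk, and `|L p|` makes `f` Lipschitz with
  -- constant `1` for the disk norm.
  let M : {p : Seminorm ℂ E // Continuous p} → ℝ := fun p => |B p| + |L p|
  have hM : ∀ p, 0 ≤ M p := fun p => by positivity
  have hcomplete := DiskSpace.completeSpace hE hM
  let g : X → DiskSpace M := fun x => ⟨f x, 1, zero_le_one, fun p => by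
    have := hB p x
    have := le_abs_self (B p)
    have := abs_nonneg (L p)
    simp only [M]
    linarith⟩
  have hg : LipschitzWith 1 g := LipschitzWith.of_dist_le_mul fun x y => by
    rw [dist_eq_norm, dist_eq_norm, NNReal.coe_one, one_mul]
    refine DiskSpace.norm_le (norm_nonneg _) fun p => ?_
    rw [map_sub, mul_comm]
    refine (hL p x y).trans (mul_le_mul_of_nonneg_right ?_ (norm_nonneg _))
    have := le_abs_self (L p)
    have := abs_nonneg (B p)
    simp only [M]
    linarith
  -- This is Bochner integrability in the Banach space of the disk. Functionals of `E` restrict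
  -- continuously to that space and commute with its integral.
  have hi : IntegrableOn (fun x => c x • g x) K μ :=
    (hc.smul hg.continuous).continuousOn.integrableOn_compact hK
  have hφ : ∀ (φ : E →L[ℂ] ℂ) x, φ (c x • f x) = DiskSpace.restrictDual φ M (c x • g x) :=
    fun φ x => rfl
  refine ⟨fun φ => ?_, DiskSpace.incl M (∫ x in K, c x • g x ∂μ), fun φ => ?_⟩
  · simp only [hφ]
    exact (DiskSpace.restrictDual φ M).integrable_comp hi
  · simp only [hφ]
    rw [ContinuousLinearMap.integral_comp_comm _ hi]
    rfl

end Dual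

/-! ### Smooth periodic functions -/

section Vector

variable {d : ℕ} {E : Type*} [AddCommGroup E] [Module ℂ E] [TopologicalSpace E]

lemma HasPartialDerivAt.dual {i : Fin d} {f : EuclideanSpace ℝ (Fin d) → E} {e : E}
    {x : EuclideanSpace ℝ (Fin d)} (h : HasPartialDerivAt i f e x) (φ : E →L[ℂ] ℂ) :
    HasPartialDerivAt i (fun x => φ (f x)) (φ e) x := by
  refine ((φ.continuous.tendsto _).comp h).congr fun r => ?_
  simp only [Function.comp_apply, ← Complex.coe_smul, map_smul, map_sub]

variable [T2Space E]

lemma IsPeriodic.partialDeriv {f : EuclideanSpace ℝ (Fin d) → E} (hf : IsPeriodic f)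
    (hs : IsSmooth f) (i : Fin d) : IsPeriodic (partialDeriv i f) := fun j x => by
  symm
  refine HasPartialDerivAt.partialDeriv_eq ?_
  refine (hs.hasPartialDerivAt i (x + EuclideanSpace.single j (2 * Real.pi))).congr fun r => ?_
  rw [add_right_comm, hf j, hf j]

variable [IsTopologicalAddGroup E] [ContinuousSMul ℂ E]

lemma IsPeriodic.exists_seminorm_bound {f : EuclideanSpace ℝ (Fin d) → E} (hf : IsPeriodic f)
    (hc : Continuous f) {p : Seminorm ℂ E} (hp : Continuous p) : ∃ C, ∀ x, p (f x) ≤ C :=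
  IsPeriodic.exists_bound (h := fun x => p (f x)) (fun j x => by simp only [hf j x]) (hp.comp hc)

variable [LocallyConvexSpace ℝ E]

/-- The mean value inequality is applied to `φ ∘ f` along the coordinate line, with `φ` norming the
difference of the two values. -/
lemma seminorm_sub_le_of_partialDeriv {f f' : EuclideanSpace ℝ (Fin d) → E} {i : Fin d}
    (hd : ∀ x, HasPartialDerivAt i f (f' x) x) {p : Seminorm ℂ E} (hp : Continuous p) {C : ℝ}
    (hC : ∀ x, p (f' x) ≤ C) (x : EuclideanSpace ℝ (Fin d)) (s : ℝ) :
    p (f (x + s • EuclideanSpace.single i (1 : ℝ)) - f x) ≤ C * |s| := by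
  obtain ⟨φ, h1, h2⟩ := exists_dual_norm_eq hp (f (x + s • EuclideanSpace.single i (1 : ℝ)) - f x)
  rw [← h1, map_sub]
  have key := Convex.norm_image_sub_le_of_norm_hasDerivWithin_le (s := Set.univ) (x := (0 : ℝ))
    (y := s) (C := C) (f := fun r : ℝ => φ (f (x + r • EuclideanSpace.single i (1 : ℝ))))
    (fun r _ => (HasPartialDerivAt.hasDerivAt
      ((hd (x + r • EuclideanSpace.single i (1 : ℝ))).dual φ)).hasDerivWithinAt)
    (fun r _ => (h2 _).trans (hC _)) convex_univ (Set.mem_univ _) (Set.mem_univ _)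
  simpa using key

/-- Passing from `y` to `x` one coordinate at a time uses only bounds on the first partial
derivatives, which are global by periodicity. -/
lemma IsPeriodic.exists_lipschitz {f : EuclideanSpace ℝ (Fin d) → E} (hf : IsPeriodic f)
    (hs : IsSmooth f) {p : Seminorm ℂ E} (hp : Continuous p) :
    ∃ C, ∀ x y, p (f x - f y) ≤ C * ‖x - y‖ := by
  choose C hC using fun i => (hf.partialDeriv hs i).exists_seminorm_bound
    (hs.partialDeriv i).continuous hp
  have hC0 : ∀ i, 0 ≤ C i := fun i => (apply_nonneg p _).trans (hC i 0)
  have key : ∀ (v : EuclideanSpace ℝ (Fin d)) (s : Finset (Fin d)) (y),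
      p (f (y + ∑ i ∈ s, v i • EuclideanSpace.single i (1 : ℝ)) - f y) ≤ ∑ i ∈ s, C i * |v i| := by
    intro v s
    induction s using Finset.induction_on with
    | empty => simp
    | insert a s ha ih =>
      intro y
      rw [Finset.sum_insert ha, Finset.sum_insert ha, ← add_assoc,
        ← sub_add_sub_cancel _ (f (y + v a • EuclideanSpace.single a (1 : ℝ))), add_comm (C a * _)]
      exact (map_add_le_add p _ _).trans (add_le_add (ih _)
        (seminorm_sub_le_of_partialDeriv (hs.hasPartialDerivAt a) hp (hC a) y _))
  refine ⟨∑ i, C i, fun x y => ?_⟩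
  have hv : y + ∑ i, (x - y) i • EuclideanSpace.single i (1 : ℝ) = x := by
    ext j
    simp [Pi.single_apply]
  have h := key (x - y) Finset.univ y
  rw [hv] at h
  refine h.trans ?_
  rw [Finset.sum_mul]
  exact Finset.sum_le_sum fun i _ =>
    mul_le_mul_of_nonneg_left (PiLp.norm_apply_le (x - y) i) (hC0 i)

lemma pettisIntegrableOn_fourierIntegrand (hE : IsLocallyComplete E) (f : periodicSmooth d E)
    (n : Fin d → ℤ) : PettisIntegrableOn (fourierIntegrand f n) (cube d) volume := by
  have hc : Continuous fun x : EuclideanSpace ℝ (Fin d) =>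
      Complex.exp (-Complex.I * pairing n x) := by
    simp only [exp_neg_pairing]
    exact continuous_exp_pairing _
  have hf : IsPeriodic (f : EuclideanSpace ℝ (Fin d) → E) := f.2
  have hs := f.1.isSmooth
  exact pettisIntegrableOn_smul (isCompact_cube d) hE hc
    (fun p hp => hf.exists_seminorm_bound hs.continuous hp) fun p hp => hf.exists_lipschitz hs hp

/-- This is the bridge to scalar analysis: since functionals separate points, identities between
coefficients can be checked on `φ ∘ f`. -/
lemma dual_fourierCoeff (hE : IsLocallyComplete E) (f : periodicSmooth d E) (n : Fin d → ℤ)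
    (φ : E →L[ℂ] ℂ) : φ (fourierCoeff f n) = scalarCoeff (fun x => φ (f x)) n := by
  have h := pettisIntegrableOn_fourierIntegrand hE f n
  rw [fourierCoeff, map_smul, pettisIntegral, dif_pos h, h.2.choose_spec φ, scalarCoeff,
    smul_eq_mul]
  simp only [fourierIntegrand, map_smul, smul_eq_mul]

end Vector

/-! ### Fourier multipliers -/

section Multiplier

variable {d : ℕ} {E : Type*} [AddCommGroup E] [Module ℂ E] [TopologicalSpace E] [T2Space E]
  [IsTopologicalAddGroup E] [ContinuousSMul ℂ E]

lemma SmoothMap.ext_apply {f g : SmoothMap d E} (h : ∀ x, f x = g x) : f = g :=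
  congrArg SmoothMap.mk (Subtype.ext (funext h))

/-- Evaluation at a point. -/
def evalAt (x : EuclideanSpace ℝ (Fin d)) : periodicSmooth d E →ₗ[ℂ] E where
  toFun f := f x
  map_add' _ _ := rfl
  map_smul' _ _ := rfl

lemma isPeriodic_coe (f : periodicSmooth d E) :
    IsPeriodic (f : EuclideanSpace ℝ (Fin d) → E) := f.2

lemma continuous_coe (f : periodicSmooth d E) :
    Continuous (f : EuclideanSpace ℝ (Fin d) → E) := f.1.isSmooth.continuous

variable (d E) in
/-- The map `e ↦ e^{i⟨n,·⟩} e`. -/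
noncomputable def expTermLinear (n : Fin d → ℤ) : E →ₗ[ℂ] periodicSmooth d E where
  toFun := expTerm n
  map_add' a b := Subtype.ext (SmoothMap.ext_apply fun x =>
    smul_add (Complex.exp (Complex.I * pairing n x)) a b)
  map_smul' c a := Subtype.ext (SmoothMap.ext_apply fun x =>
    smul_comm (Complex.exp (Complex.I * pairing n x)) c a)

/-- The operator `D` preserves periodicity and multiplies the `n`-th Fourier mode by `c n`. -/
structure IsMultiplier (D : Module.End ℂ (SmoothMap d E)) (c : (Fin d → ℤ) → ℂ) : Prop where
  mem : ∀ f ∈ periodicSmooth d E, D f ∈ periodicSmooth d E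
  coeff : ∀ f ∈ periodicSmooth d E, ∀ n, fourierCoeff (D f) n = c n • fourierCoeff f n
  map_expTerm : ∀ n (e : E), D (expTerm n e) = c n • (expTerm n e : SmoothMap d E)

namespace IsMultiplier

variable {D D' : Module.End ℂ (SmoothMap d E)} {c c' : (Fin d → ℤ) → ℂ}

lemma one : IsMultiplier (1 : Module.End ℂ (SmoothMap d E)) 1 :=
  ⟨fun _ hf => hf, fun _ _ _ => (one_smul _ _).symm, fun _ _ => (one_smul _ _).symm⟩

lemma mul (h : IsMultiplier D c) (h' : IsMultiplier D' c') : IsMultiplier (D * D') (c * c') where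
  mem f hf := h.mem _ (h'.mem f hf)
  coeff f hf n := by
    rw [Module.End.mul_apply, h.coeff _ (h'.mem f hf), h'.coeff f hf, Pi.mul_apply, mul_smul]
  map_expTerm n e := by
    rw [Module.End.mul_apply, h'.map_expTerm, map_smul, h.map_expTerm, Pi.mul_apply, smul_smul,
      mul_comm]

lemma pow (h : IsMultiplier D c) (k : ℕ) : IsMultiplier (D ^ k) (c ^ k) := by
  induction k with
  | zero => simpa only [pow_zero] using one
  | succ k ih => simpa only [pow_succ] using ih.mul h

/-- The operators are multiplied as a list because no commutation is assumed, which is also the form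
of `iteratedPd`; the symbols commute. -/
lemma prod_ofFn {m : ℕ} {D : Fin m → Module.End ℂ (SmoothMap d E)}
    {c : Fin m → (Fin d → ℤ) → ℂ} (h : ∀ i, IsMultiplier (D i) (c i)) :
    IsMultiplier (List.ofFn D).prod (∏ i, c i) := by
  induction m with
  | zero => simpa using one
  | succ m ih =>
    rw [List.ofFn_succ, List.prod_cons, Fin.prod_univ_succ]
    exact (h 0).mul (ih fun i => h i.succ)

end IsMultiplier

variable [LocallyConvexSpace ℝ E]

/-- The Fourier coefficient as a linear map. -/
noncomputable def fourierCoeffLinear (hE : IsLocallyComplete E) (n : Fin d → ℤ) :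
    periodicSmooth d E →ₗ[ℂ] E where
  toFun f := fourierCoeff f n
  map_add' f g := eq_of_forall_dual fun φ => by
    rw [map_add, dual_fourierCoeff hE, dual_fourierCoeff hE, dual_fourierCoeff hE,
      ← scalarCoeff_add (g := fun x => φ (f x)) (h := fun x => φ (g x))
        (φ.continuous.comp (continuous_coe f)) (φ.continuous.comp (continuous_coe g))]
    simp only [Submodule.coe_add, SmoothMap.coe_add, map_add]
  map_smul' c f := eq_of_forall_dual fun φ => by
    rw [RingHom.id_apply, map_smul, dual_fourierCoeff hE, dual_fourierCoeff hE, smul_eq_mul,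
      ← scalarCoeff_const_mul]
    simp only [Submodule.coe_smul, SmoothMap.coe_smul, map_smul, smul_eq_mul]

lemma fourierCoeff_expTerm (hE : IsLocallyComplete E) (m n : Fin d → ℤ) (e : E) :
    fourierCoeff (expTerm m e : periodicSmooth d E) n = if n = m then e else 0 := by
  refine eq_of_forall_dual fun φ => ?_
  rw [dual_fourierCoeff hE]
  have h : ∀ x, φ ((expTerm m e : periodicSmooth d E) x) =
      φ e * Complex.exp (Complex.I * pairing m x) := fun x => by
    change φ (Complex.exp (Complex.I * pairing m x) • e) = _
    rw [map_smul, smul_eq_mul, mul_comm]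
  simp only [h]
  rw [scalarCoeff_const_mul, scalarCoeff_exp]
  split_ifs <;> simp

/-- A functional norming the coefficient reduces this to the scalar bound. As only values on the
compact cube enter, the estimate also yields continuity of the coefficient map. -/
lemma seminorm_fourierCoeff_le (hE : IsLocallyComplete E) {p : Seminorm ℂ E}
    (hp : Continuous p) {f : periodicSmooth d E}
    {C : ℝ} (hC : ∀ x ∈ cube d, p (f x) ≤ C) (n : Fin d → ℤ) : p (fourierCoeff f n) ≤ C := by
  obtain ⟨φ, h1, h2⟩ := exists_dual_norm_eq hp (fourierCoeff f n)
  rw [← h1, dual_fourierCoeff hE]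
  exact norm_scalarCoeff_le (fun x hx => (h2 _).trans (hC x hx)) n

namespace IsMultiplier

variable {D D' : Module.End ℂ (SmoothMap d E)} {c c' : (Fin d → ℤ) → ℂ}

lemma sub (hE : IsLocallyComplete E) (h : IsMultiplier D c) (h' : IsMultiplier D' c') :
    IsMultiplier (D - D') (c - c') where
  mem f hf := Submodule.sub_mem _ (h.mem f hf) (h'.mem f hf)
  coeff f hf n := by
    have key := map_sub (fourierCoeffLinear hE n) ⟨D f, h.mem f hf⟩ ⟨D' f, h'.mem f hf⟩
    change fourierCoeff (D f - D' f) n = fourierCoeff (D f) n - fourierCoeff (D' f) n at key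
    rw [LinearMap.sub_apply, key, h.coeff f hf, h'.coeff f hf, Pi.sub_apply, sub_smul]
  map_expTerm n e := by
    rw [LinearMap.sub_apply, h.map_expTerm, h'.map_expTerm, Pi.sub_apply, sub_smul]

lemma pd (hE : IsLocallyComplete E) (i : Fin d) :
    IsMultiplier (SmoothMap.pd (E := E) i) fun n => Complex.I * n i where
  mem f hf := IsPeriodic.partialDeriv hf f.isSmooth i
  coeff f hf n := by
    have hf' : IsPeriodic (f : EuclideanSpace ℝ (Fin d) → E) := hf
    have hp : IsPeriodic (partialDeriv i f) := hf'.partialDeriv f.isSmooth i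
    refine eq_of_forall_dual fun φ => ?_
    have e1 := dual_fourierCoeff hE ⟨SmoothMap.pd i f, hp⟩ n φ
    have e2 := dual_fourierCoeff hE ⟨f, hf⟩ n φ
    rw [map_smul]
    refine e1.trans ?_
    rw [e2, smul_eq_mul]
    exact scalarCoeff_partialDeriv (fun j x => congrArg φ (hf' j x))
      (fun j x => congrArg φ (hp j x)) (φ.continuous.comp f.isSmooth.continuous)
      (φ.continuous.comp (f.isSmooth.partialDeriv i).continuous)
      (fun x => (f.isSmooth.hasPartialDerivAt i x).dual φ) n
  map_expTerm n e := SmoothMap.ext_apply fun x => by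
    refine (hasPartialDerivAt_exp n e i x).partialDeriv_eq.trans ?_
    exact smul_comm (Complex.exp (Complex.I * pairing n x)) _ e

/-- The symbol is `∏ i, (I * n i) ^ β i`, but later arguments need only that some symbol exists. -/
lemma iteratedPd (hE : IsLocallyComplete E) (β : Fin d → ℕ) :
    ∃ c, IsMultiplier (SmoothMap.iteratedPd (E := E) β) c :=
  ⟨_, prod_ofFn fun i => (pd hE i).pow (β i)⟩

end IsMultiplier

/-! ### Decay of the Fourier coefficients and convergence of the Fourier series -/

lemma summable_prod_inv_one_add_sq (d : ℕ) :
    Summable fun n : Fin d → ℤ => ∏ i, (1 + (n i : ℝ) ^ 2)⁻¹ := by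
  have h1 : Summable fun k : ℤ => (1 + (k : ℝ) ^ 2)⁻¹ := by
    -- At `k = 0` the majorant `1 / k ^ 2` is `0` by convention, so the comparison is made off this
    -- one point.
    refine ((Real.summable_one_div_int_pow (p := 2)).2 one_lt_two).of_norm_bounded_eventually ?_
    rw [Filter.eventually_cofinite]
    refine (Set.finite_singleton (0 : ℤ)).subset fun k hk => ?_
    by_contra hk0
    have hk1 : (0 : ℝ) < (k : ℝ) ^ 2 := by
      have : (k : ℝ) ≠ 0 := by exact_mod_cast hk0
      positivity
    refine hk ?_
    rw [Real.norm_of_nonneg (by positivity), one_div]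
    exact inv_anti₀ hk1 (by linarith)
  induction d with
  | zero => exact (hasSum_fintype _).summable
  | succ d ih =>
    rw [← (Fin.consEquiv fun _ : Fin (d + 1) => ℤ).summable_iff]
    have h2 := h1.mul_of_nonneg ih (fun k => by positivity) (fun n => by positivity)
    refine h2.congr fun a => ?_
    simp [Fin.prod_univ_succ, Fin.consEquiv, mul_comm]

/-- The product of the operators `1 - ∂ᵢ²` has symbol `∏ (1 + n i ^ 2)`. Applied to `f` it gives a
smooth periodic function with bounded coefficients, so dividing by the symbol leaves a summable
majorant. -/
lemma summable_seminorm_fourierCoeff (hE : IsLocallyComplete E) (f : periodicSmooth d E)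
    {p : Seminorm ℂ E}
    (hp : Continuous p) : Summable fun n => p (fourierCoeff f n) := by
  have hW : IsMultiplier (List.ofFn fun i : Fin d => 1 - SmoothMap.pd (E := E) i ^ 2).prod
      (∏ i, (1 - (fun n : Fin d → ℤ => Complex.I * (n i : ℂ)) ^ 2) : (Fin d → ℤ) → ℂ) :=
    IsMultiplier.prod_ofFn fun i => IsMultiplier.one.sub hE ((IsMultiplier.pd hE i).pow 2)
  obtain ⟨C, hC⟩ := IsPeriodic.exists_seminorm_bound (hW.mem f f.2)
    (SmoothMap.isSmooth _).continuous hp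
  refine Summable.of_nonneg_of_le (fun n => apply_nonneg _ _) (fun n => ?_)
    ((summable_prod_inv_one_add_sq d).mul_left C)
  have h1 := seminorm_fourierCoeff_le hE hp (f := ⟨_, hW.mem f f.2⟩) (fun x _ => hC x) n
  have h2 : (∏ i, (1 - (fun n : Fin d → ℤ => Complex.I * (n i : ℂ)) ^ 2) : (Fin d → ℤ) → ℂ) n =
      ((∏ i, (1 + (n i : ℝ) ^ 2) : ℝ) : ℂ) := by
    rw [Finset.prod_apply, Complex.ofReal_prod]
    refine Finset.prod_congr rfl fun i _ => ?_
    simp [mul_pow]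
  have h3 : (0 : ℝ) < ∏ i, (1 + (n i : ℝ) ^ 2) := Finset.prod_pos fun i _ => by positivity
  rw [hW.coeff f f.2, h2, map_smul_eq_mul, Complex.norm_of_nonneg h3.le] at h1
  rw [Finset.prod_inv_distrib, ← div_eq_mul_inv, le_div_iff₀ h3, mul_comm]
  exact h1

lemma hasSum_dual_fourierCoeff (hE : IsLocallyComplete E) (f : periodicSmooth d E) (φ : E →L[ℂ] ℂ)
    (x : EuclideanSpace ℝ (Fin d)) :
    HasSum (fun n => φ ((expTerm n (fourierCoeff f n) : periodicSmooth d E) x)) (φ (f x)) := by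
  have hs : Summable (scalarCoeff fun x => φ (f x)) := by
    refine (summable_seminorm_fourierCoeff hE f (p := φ.toSeminorm)
      φ.continuous.norm).of_norm_bounded fun n => ?_
    rw [← dual_fourierCoeff hE]
    exact le_rfl
  have key := IsPeriodic.hasSum_scalarCoeff (h := fun x => φ (f x))
    (fun j x => congrArg φ (isPeriodic_coe f j x)) (φ.continuous.comp (continuous_coe f)) hs x
  simp only [← dual_fourierCoeff hE] at key
  refine key.congr_fun fun n => ?_
  exact map_smul φ (Complex.exp (Complex.I * pairing n x)) (fourierCoeff f n)

/-- Uniform convergence of the Fourier series with respect to a continuous seminorm. -/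
lemma eventually_seminorm_sum_sub_le (hE : IsLocallyComplete E) (f : periodicSmooth d E)
    {p : Seminorm ℂ E}
    (hp : Continuous p) {ε : ℝ} (hε : 0 < ε) :
    ∀ᶠ s : Finset (Fin d → ℤ) in atTop, ∀ x,
      p (((∑ n ∈ s, expTerm n (fourierCoeff f n)) - f : periodicSmooth d E) x) ≤ ε := by
  have ha := summable_seminorm_fourierCoeff hE f hp
  filter_upwards [(tendsto_tsum_compl_atTop_zero
    fun n => p (fourierCoeff f n)).eventually_le_const hε] with s hs x
  refine le_trans ?_ hs
  -- The functional depends on `x` and `s`, but the resulting tail bound involves only `p` and the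
  -- coefficients, so it is uniform in `x`.
  obtain ⟨φ, h1, h2⟩ := exists_dual_norm_eq hp
    (((∑ n ∈ s, expTerm n (fourierCoeff f n)) - f : periodicSmooth d E) x)
  rw [← h1]
  have hb := hasSum_dual_fourierCoeff hE f φ x
  have e : φ (((∑ n ∈ s, expTerm n (fourierCoeff f n)) - f : periodicSmooth d E) x) =
      -∑' n : {n // n ∉ s}, φ ((expTerm n.1 (fourierCoeff f n.1) : periodicSmooth d E) x) := by
    have e1 := map_sub (φ.toLinearMap ∘ₗ evalAt x) (∑ n ∈ s, expTerm n (fourierCoeff f n)) f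
    rw [map_sum] at e1
    refine e1.trans ?_
    have e2 := hb.summable.sum_add_tsum_subtype_compl s
    rw [hb.tsum_eq] at e2
    change (∑ n ∈ s, φ ((expTerm n (fourierCoeff f n) : periodicSmooth d E) x)) - φ (f x) = _
    rw [← e2]
    ring
  rw [e, norm_neg]
  refine tsum_of_norm_bounded (ha.subtype _).hasSum fun n => (h2 _).trans ?_
  change p (Complex.exp (Complex.I * pairing n.1 x) • fourierCoeff f n.1) ≤ _
  rw [map_smul_eq_mul, mul_comm Complex.I, Complex.norm_exp_ofReal_mul_I, one_mul]
  rfl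

variable (d E) in
lemma withSeminorms_periodicSmooth :
    WithSeminorms ((SmoothMap.seminormFamily d E).comp (periodicSmooth d E).subtype) :=
  IsInducing.withSeminorms (f := (periodicSmooth d E).subtype) ⟨rfl⟩ IsInducing.subtypeVal

/-- A smooth periodic function is the unconditional sum of its Fourier series. -/
theorem hasSum_expTerm_fourierCoeff (hE : IsLocallyComplete E) (f : periodicSmooth d E) :
    HasSum (fun n => expTerm n (fourierCoeff f n)) f := by
  refine ((withSeminorms_periodicSmooth d E).tendsto_nhds _ _).2 fun ⟨K, l, p⟩ ε hε => ?_
  have h : ∀ β ∈ SmoothMap.multiIndices d l, ∀ᶠ s : Finset (Fin d → ℤ) in atTop,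
      SmoothMap.supSeminorm K p (SmoothMap.iteratedPd β
        ((∑ n ∈ s, expTerm n (fourierCoeff f n) - f : periodicSmooth d E) : SmoothMap d E)) < ε := by
    intro β _
    obtain ⟨c, hc⟩ := IsMultiplier.iteratedPd (E := E) hE β
    -- Applying `∂^β` to the error of the Fourier sum of `f` gives the error of the Fourier sum of
    -- `g = ∂^β f`, so the uniform estimate applies to `g`.
    let g : periodicSmooth d E := ⟨SmoothMap.iteratedPd β f, hc.mem f f.2⟩
    filter_upwards [eventually_seminorm_sum_sub_le hE g p.2 (half_pos hε)] with s hs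
    have e : SmoothMap.iteratedPd β
        ((∑ n ∈ s, expTerm n (fourierCoeff f n) - f : periodicSmooth d E) : SmoothMap d E) =
        (∑ n ∈ s, expTerm n (fourierCoeff g n) - g : periodicSmooth d E) := by
      simp only [Submodule.coe_sub, Submodule.coe_sum, map_sub, map_sum, hc.map_expTerm]
      congr 1
      refine Finset.sum_congr rfl fun n _ => ?_
      have e1 : fourierCoeff g n = c n • fourierCoeff f n := hc.coeff f f.2 n
      rw [e1]
      exact congrArg Subtype.val (map_smul (expTermLinear d E n) (c n) (fourierCoeff f n)).symm
    rw [e]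
    -- A supremum of pointwise bounds is controlled only with `≤`; the estimate with `ε / 2`
    -- restores strictness.
    refine lt_of_le_of_lt ?_ (half_lt_self hε)
    exact Real.iSup_le (fun x => hs x) (half_pos hε).le
  exact ((Finset.eventually_all _).2 h).mono fun s hs => Seminorm.finset_sup_apply_lt hε hs

end Multiplier

/-! ### The Schauder decomposition -/

section Schauder

open scoped NNReal

variable {d : ℕ} {E : Type*} [AddCommGroup E] [Module ℂ E] [TopologicalSpace E] [T2Space E]
  [IsTopologicalAddGroup E] [ContinuousSMul ℂ E] [LocallyConvexSpace ℝ E]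

/-- The coefficient is dominated by the seminorm with `K = cube d` and `l = 0`, in which `β = 0`
contributes the supremum of `p ∘ f` itself. -/
lemma continuous_fourierCoeffLinear (hE : IsLocallyComplete E) (n : Fin d → ℤ) :
    Continuous (fourierCoeffLinear (E := E) hE n) := by
  have hq := withSeminorms_periodicSmooth d E
  have := hq.topologicalAddGroup
  refine (PolynormableSpace.withSeminorms ℂ E).continuous_of_continuous_comp _ fun p =>
    Seminorm.continuous_of_le (hq.continuous_seminorm (⟨cube d, isCompact_cube d⟩, 0, p)) fun f =>
      seminorm_fourierCoeff_le hE p.2 (fun x hx => ?_) n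
  have h0 : (0 : Fin d → ℕ) ∈ SmoothMap.multiIndices d 0 := by
    simp [SmoothMap.multiIndices]
  have h1 : SmoothMap.iteratedPd (E := E) (0 : Fin d → ℕ) = 1 := by
    simp [SmoothMap.iteratedPd, List.ofFn_const]
  have h2 := Seminorm.le_finset_sup_apply (x := (f : SmoothMap d E)) h0
    (p := fun β => (SmoothMap.supSeminorm ⟨cube d, isCompact_cube d⟩ p).comp
      (SmoothMap.iteratedPd β))
  rw [Seminorm.comp_apply, h1] at h2
  exact (le_ciSup (SmoothMap.bddAbove_comp ⟨cube d, isCompact_cube d⟩ p f)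
    (⟨x, hx⟩ : cube d)).trans h2

/-- Each `∂^β` multiplies the mode by a scalar, and `C`, the sum of the norms of these scalars over
`|β| ≤ l`, dominates all of them at once. -/
lemma continuous_expTermLinear (hE : IsLocallyComplete E) (n : Fin d → ℤ) :
    Continuous (expTermLinear d E n) := by
  refine (withSeminorms_periodicSmooth d E).continuous_of_continuous_comp _ fun ⟨K, l, p⟩ => ?_
  choose c hc using IsMultiplier.iteratedPd (d := d) (E := E) hE
  let C : ℝ≥0 := ∑ β ∈ SmoothMap.multiIndices d l, ‖c β n‖₊
  refine Seminorm.continuous_of_le (q := C • p.1) (p.2.const_smul C) fun e => ?_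
  refine Seminorm.finset_sup_apply_le (apply_nonneg _ _) fun β hβ => ?_
  have hCβ : ‖c β n‖ ≤ C :=
    Finset.single_le_sum (f := fun β => ‖c β n‖₊) (fun _ _ => zero_le) hβ
  have h1 : SmoothMap.iteratedPd β (expTerm n e : SmoothMap d E) =
      c β n • (expTerm n e : SmoothMap d E) := (hc β).map_expTerm n e
  change SmoothMap.supSeminorm K p (SmoothMap.iteratedPd β (expTerm n e : SmoothMap d E)) ≤
    C * p.1 e
  rw [h1, map_smul_eq_mul]
  refine mul_le_mul hCβ (Real.iSup_le (fun x => ?_) (apply_nonneg _ _)) (apply_nonneg _ _) C.2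
  change p.1 (Complex.exp (Complex.I * pairing n x) • e) ≤ _
  rw [map_smul_eq_mul, mul_comm Complex.I, Complex.norm_exp_ofReal_mul_I, one_mul]

/-- The Fourier partial sum as a continuous linear operator. -/
noncomputable def fourierProjection (hE : IsLocallyComplete E) (k : ℕ) :
    periodicSmooth d E →L[ℂ] periodicSmooth d E where
  toLinearMap := ∑ n ∈ latticeBall d k, expTermLinear d E n ∘ₗ fourierCoeffLinear hE n
  cont := by
    have := (withSeminorms_periodicSmooth d E).topologicalAddGroup
    exact (continuous_finsetSum (latticeBall d k) fun n _ => (continuous_expTermLinear hE n).comp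
      (continuous_fourierCoeffLinear (d := d) hE n)).congr fun f => (LinearMap.sum_apply (latticeBall d k)
        (fun n => expTermLinear d E n ∘ₗ fourierCoeffLinear hE n) f).symm

lemma fourierProjection_apply (hE : IsLocallyComplete E) (k : ℕ) (f : periodicSmooth d E) :
    fourierProjection hE k f = fourierPartialSum k f := by
  change (∑ n ∈ latticeBall d k, expTermLinear d E n ∘ₗ fourierCoeffLinear hE n) f = _
  rw [LinearMap.sum_apply]
  rfl

/-- By orthogonality a partial sum keeps or kills each single mode. The composition law then becomes
an intersection of balls. -/
lemma fourierPartialSum_expTerm (hE : IsLocallyComplete E) (k : ℕ) (m : Fin d → ℤ) (e : E) :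
    fourierPartialSum k (expTerm m e : periodicSmooth d E) =
      if m ∈ latticeBall d k then expTerm m e else 0 := by
  have h : ∀ n, expTerm n (fourierCoeff (expTerm m e : periodicSmooth d E) n) =
      if n = m then expTerm m e else (0 : periodicSmooth d E) := fun n => by
    rw [fourierCoeff_expTerm hE]
    split_ifs with hn
    · rw [hn]
    · exact map_zero (expTermLinear d E n)
  rw [fourierPartialSum, Finset.sum_congr rfl fun n _ => h n]
  exact Finset.sum_ite_eq' _ _ _

lemma mem_latticeBall_min {j k : ℕ} {n : Fin d → ℤ} :
    n ∈ latticeBall d (min j k) ↔ n ∈ latticeBall d k ∧ n ∈ latticeBall d j := by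
  simp only [mem_latticeBall, Nat.cast_min, le_min_iff, and_comm]

lemma fourierProjection_comp (hE : IsLocallyComplete E) (j k : ℕ) :
    (fourierProjection (d := d) hE k).comp (fourierProjection hE j) =
      fourierProjection hE (min j k) := by
  ext1 f
  rw [ContinuousLinearMap.comp_apply, fourierProjection_apply hE j f, fourierPartialSum, map_sum,
    fourierProjection_apply hE (min j k) f, fourierPartialSum]
  simp only [fourierProjection_apply, fourierPartialSum_expTerm hE]
  rw [← Finset.sum_filter]
  refine Finset.sum_congr ?_ fun _ _ => rfl
  ext n
  rw [Finset.mem_filter, mem_latticeBall_min, and_comm]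

/-- The frequency with first coordinate `k` and all others `0` has norm exactly `k`. A nonzero mode
there is fixed by the `k`-th projection and killed by the `j`-th. -/
lemma fourierProjection_ne_of_lt [Nontrivial E] (hd : 1 ≤ d) (hE : IsLocallyComplete E) {j k : ℕ}
    (hjk : j < k) : fourierProjection (d := d) hE k ≠ fourierProjection hE j := by
  intro h
  obtain ⟨e, he⟩ := exists_ne (0 : E)
  let n : Fin d → ℤ := Pi.single ⟨0, hd⟩ (k : ℤ)
  have hn : latticeNorm n = k := by
    rw [latticeNorm, Finset.sum_eq_single ⟨0, hd⟩ (fun i _ hi => by simp [n, hi]) (by simp)]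
    simp [n]
  have h1 := DFunLike.congr_fun h (expTerm n e)
  rw [fourierProjection_apply, fourierProjection_apply, fourierPartialSum_expTerm hE,
    fourierPartialSum_expTerm hE, if_pos (mem_latticeBall.2 hn.le),
    if_neg (fun hm => absurd (hn ▸ mem_latticeBall.1 hm) (by simpa using hjk))] at h1
  have h2 : Complex.exp (Complex.I * pairing n 0) • e = 0 :=
    congrArg (evalAt (0 : EuclideanSpace ℝ (Fin d))) h1
  exact he ((smul_eq_zero.1 h2).resolve_left (Complex.exp_ne_zero _))

/-- The balls eventually contain every finite set of frequencies, so unconditional convergence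
specializes to convergence along them. -/
lemma tendsto_latticeBall (d : ℕ) : Tendsto (latticeBall d) atTop atTop := by
  refine tendsto_atTop_finset_of_monotone (fun j k hjk n hn => ?_) fun n => ?_
  · rw [mem_latticeBall] at hn ⊢
    exact hn.trans (by exact_mod_cast hjk)
  · obtain ⟨k, hk⟩ := exists_nat_ge (latticeNorm n)
    exact ⟨k, mem_latticeBall.2 hk⟩

/-- The Fourier partial sums over Euclidean balls form a Schauder decomposition. -/
theorem isSchauderDecomposition_fourierProjection [Nontrivial E] (hd : 1 ≤ d)
    (hE : IsLocallyComplete E) : IsSchauderDecomposition (fourierProjection (d := d) hE) where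
  comp_eq := fourierProjection_comp hE
  ne_of_ne j k hkj := by
    rcases hkj.lt_or_gt with h | h
    · exact (fourierProjection_ne_of_lt hd hE h).symm
    · exact fourierProjection_ne_of_lt hd hE h
  tendsto f := by
    simp only [fourierProjection_apply]
    exact (hasSum_expTerm_fourierCoeff hE f).comp (tendsto_latticeBall d)

end Schauder

end SmoothFourier

theorem theorem4p10 (d : ℕ) (hd : 1 ≤ d) (E : Type*) [AddCommGroup E] [Module ℂ E]
    [TopologicalSpace E] [IsTopologicalAddGroup E] [ContinuousSMul ℂ E] [LocallyConvexSpace ℝ E]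
    [T2Space E] [Nontrivial E] (hE : SmoothFourier.IsLocallyComplete E) :
    (∀ (f : SmoothFourier.periodicSmooth d E) (n : Fin d → ℤ),
      SmoothFourier.PettisIntegrableOn (SmoothFourier.fourierIntegrand f n)
        (SmoothFourier.cube d) volume) ∧
    (∃ P : ℕ → SmoothFourier.periodicSmooth d E →L[ℂ] SmoothFourier.periodicSmooth d E,
      (∀ k f, P k f = SmoothFourier.fourierPartialSum k f) ∧
        SmoothFourier.IsSchauderDecomposition P) ∧
    ∀ f : SmoothFourier.periodicSmooth d E,
      HasSum (fun n : Fin d → ℤ => SmoothFourier.expTerm n (SmoothFourier.fourierCoeff f n)) f :=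
  ⟨SmoothFourier.pettisIntegrableOn_fourierIntegrand hE,
    ⟨SmoothFourier.fourierProjection hE, SmoothFourier.fourierProjection_apply hE,
      SmoothFourier.isSchauderDecomposition_fourierProjection hd hE⟩,
    SmoothFourier.hasSum_expTerm_fourierCoeff hE⟩
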